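/- Let $\mathcal S,\mathcal X,\mathcal Y_1,\mathcal Y_2$ be finite sets, $P_S$ a pmf on $\mathcal S$, $P_{Y_1Y_2|XS}$ a transition probability from $\mathcal X\times\mathcal S$ to $\mathcal Y_1\times\mathcal Y_2$, $\phi:\mathcal X\to[0,\infty)$ a cost function and $\Gamma>0$. All logarithms are to base $2$. For $n\ge 1$ and $R_0,R_1,R_2\ge 0$ let $\mathcal I_{R}=\{1,\dots,\lfloor 2^{nR}\rfloor\}$. A $(2^{nR_0},2^{nR_1},2^{nR_2},n)$ code consists of an encoder $x^n(m_0,m_1,m_2,s^n)\in\mathcal X^n$, defined for all $(m_0,m_1,m_2,s^n)\in\mathcal I_{R_0}\times\mathcal I_{R_1}\times\mathcal I_{R_2}\times\mathcal S^n$, and of two decoders, which map $y_1^n\in\mathcal Y_1^n$ to $(\hat m_{01},\hat m_1)\in\mathcal I_{R_0}\times\mathcal I_{R_1}$ and $y_2^n\in\mathcal Y_2^n$ to $(\hat m_{02},\hat m_2)\in\mathcal I_{R_0}\times\mathcal I_{R_2}$. The messages $(M_0,M_1,M_2)$ are uniformly distributed on $\mathcal I_{R_0}\times\mathcal I_{R_1}\times\mathcal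 I_{R_2}$, the state sequence $S^n$ is i.i.d. with law $P_S$ and independent of the messages, $X^n=x^n(M_0,M_1,M_2,S^n)$, and, given $(M_0,M_1,M_2,S^n)$, the outputs have law $\prod_{i=1}^n P_{Y_1Y_2|XS}(y_{1i},y_{2i}|X_i,S_i)$. Put $P_e^{(n)}=\Pr\big[\bigcup_{k=1}^2\{(\hat M_{0k},\hat M_k)\ne(M_0,M_k)\}\big]$. A quintuple $(R_0,R_1,R_2,E_1,E_2)$ of real numbers with $R_0,R_1,R_2\ge 0$ is achievable if for every $\epsilon>0$ and all sufficiently large $n$ there is a $(2^{nR_0},2^{nR_1},2^{nR_2},n)$ code with $\frac1n\sum_{i=1}^n\phi(X_i)\le\Gamma$ almost surely, $P_e^{(n)}\le\epsilon$, and $\frac1n I(S^n;Y_k^n)\le E_k+\epsilon$ for $k=1,2$. Claim: if $(R_0,R_1,R_2,E_1,E_2)$ is achievable, then there are finite sets $\mathcal W,\mathcal U,\mathcal V$ and a conditional distribution $P_{WUVX|S}$ on $\mathcal W\times\mathcal U\times\mathcal V\times\mathcal X$ such that, for $(S,W,U,V,X,Y_1,Y_2)$ with joint law $P_S\,P_{WUVX|S}\,P_{Y_1Y_2|XS}$,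 $$R_0\le \min\{I(W;Y_1|S),I(W;Y_2|S)\},$$ $$R_0+R_1\le \min\{I(W;Y_1|S),I(W;Y_2|S)\}+I(U;Y_1|W,S),$$ $$R_0+R_2\le \min\{I(W;Y_1|S),I(W;Y_2|S)\}+I(V;Y_2|W,S),$$ $$R_0+R_1+R_2\le \min\{I(W;Y_1|S),I(W;Y_2|S)\}+I(U;Y_1|W,S)+I(X;Y_2|W,U,S),$$ $$R_0+R_1+R_2\le \min\{I(W;Y_1|S),I(W;Y_2|S)\}+I(X;Y_1|W,V,S)+I(V;Y_2|W,S),$$ $$E_k\ge I(S;Y_k),\qquad k=1,2.$$ -/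

import Mathlib

/-! Probability mass functions on a finite set `Ω` are the elements of `stdSimplex ℝ Ω`; a random
variable on the finite probability space `(Ω, p)` is a function on `Ω`. All logarithms are to
base two, so that rates and information quantities are in bits. -/

noncomputable section

open scoped NNReal

namespace StateMasking

section Information

variable {Ω A B C : Type*} [Fintype Ω] [Fintype A] [Fintype B] [Fintype C]

open Classical in
/-- The probability of an event. -/
def prob (p : Ω → ℝ) (E : Set Ω) : ℝ := ∑ ω, if ω ∈ E then p ω else 0

/-- The pmf of the random variable `X`. -/
def law (p : Ω → ℝ) (X : Ω → A) (a : A) : ℝ := prob p {ω | X ω = a}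

/-- Entropy `H(X) = - ∑ P(a) log P(a)`. -/
def entropy (p : Ω → ℝ) (X : Ω → A) : ℝ := - ∑ a, law p X a * Real.logb 2 (law p X a)

/-- Conditional entropy `H(X | Y) = - ∑ P(a, b) log (P(a, b) / P(b))`. -/
def condEntropy (p : Ω → ℝ) (X : Ω → A) (Y : Ω → B) : ℝ :=
  - ∑ a, ∑ b, law p (fun ω => (X ω, Y ω)) (a, b) *
      Real.logb 2 (law p (fun ω => (X ω, Y ω)) (a, b) / law p Y b)

/-- Mutual information `I(X; Y) = H(X) - H(X | Y)`. -/
def mutualInfo (p : Ω → ℝ) (X : Ω → A) (Y : Ω → B) : ℝ := entropy p X - condEntropy p X Y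

/-- Conditional mutual information `I(X; Y | Z) = H(X | Z) - H(X | Y, Z)`. -/
def condMutualInfo (p : Ω → ℝ) (X : Ω → A) (Y : Ω → B) (Z : Ω → C) : ℝ :=
  condEntropy p X Z - condEntropy p X (fun ω => (Y ω, Z ω))

end Information

section Channel

variable {S X Y₁ Y₂ : Type*} [Fintype S] [Fintype Y₁] [Fintype Y₂]

/-- A two-receiver discrete memoryless broadcast channel with random parameters: the state pmf
`P_S` and the transition function `P_{Y₁ Y₂ | X S}`. -/
structure Channel (S X Y₁ Y₂ : Type*) [Fintype S] [Fintype Y₁] [Fintype Y₂] where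
  /-- `P_S(s)` -/
  stateP : S → ℝ
  stateP_mem : stateP ∈ stdSimplex ℝ S
  /-- `P_{Y₁ Y₂ | X S}(y₁, y₂ | x, s)` -/
  trans : X → S → Y₁ × Y₂ → ℝ
  trans_mem : ∀ x s, trans x s ∈ stdSimplex ℝ (Y₁ × Y₂)

/-- The message set `{1, ..., 2^{nR}}`, with `⌊2^{nR}⌋` elements. -/
abbrev Msg (n : ℕ) (R : ℝ) : Type := Fin ⌊(2 : ℝ) ^ ((n : ℝ) * R)⌋₊

/-- A block code of length `n` with message sets `M₀`, `M₁`, `M₂`, whose encoder knows the whole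
state sequence. -/
structure Code (n : ℕ) (M₀ M₁ M₂ S X Y₁ Y₂ : Type*) where
  enc : M₀ → M₁ → M₂ → (Fin n → S) → (Fin n → X)
  dec₁ : (Fin n → Y₁) → M₀ × M₁
  dec₂ : (Fin n → Y₂) → M₀ × M₂

/-- Outcomes of one block transmission: the messages, the state sequence and the two received
sequences. -/
structure Outcome (n : ℕ) (M₀ M₁ M₂ S Y₁ Y₂ : Type*) where
  m₀ : M₀
  m₁ : M₁
  m₂ : M₂
  s : Fin n → S
  y₁ : Fin n → Y₁
  y₂ : Fin n → Y₂

/-- Outcomes as tuples. -/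
def Outcome.equiv (n : ℕ) (M₀ M₁ M₂ S Y₁ Y₂ : Type*) :
    Outcome n M₀ M₁ M₂ S Y₁ Y₂ ≃
      M₀ × M₁ × M₂ × (Fin n → S) × (Fin n → Y₁) × (Fin n → Y₂) where
  toFun ω := (ω.m₀, ω.m₁, ω.m₂, ω.s, ω.y₁, ω.y₂)
  invFun t := ⟨t.1, t.2.1, t.2.2.1, t.2.2.2.1, t.2.2.2.2.1, t.2.2.2.2.2⟩
  left_inv _ := rfl
  right_inv _ := rfl

instance (n : ℕ) (M₀ M₁ M₂ S Y₁ Y₂ : Type*) [Fintype M₀] [Fintype M₁] [Fintype M₂] [Fintype S]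
    [Fintype Y₁] [Fintype Y₂] : Fintype (Outcome n M₀ M₁ M₂ S Y₁ Y₂) :=
  Fintype.ofEquiv _ (Outcome.equiv n M₀ M₁ M₂ S Y₁ Y₂).symm

namespace Code

variable {n : ℕ} {M₀ M₁ M₂ : Type*} [Fintype M₀] [Fintype M₁] [Fintype M₂]

/-- The channel input sequence `X^n`. -/
def input (c : Code n M₀ M₁ M₂ S X Y₁ Y₂) (ω : Outcome n M₀ M₁ M₂ S Y₁ Y₂) : Fin n → X :=
  c.enc ω.m₀ ω.m₁ ω.m₂ ω.s

/-- The joint pmf of messages, states and channel outputs: the messages are uniform, the states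
are i.i.d. and independent of the messages, and the channel is memoryless without feedback. -/
def joint (c : Code n M₀ M₁ M₂ S X Y₁ Y₂) (ch : Channel S X Y₁ Y₂)
    (ω : Outcome n M₀ M₁ M₂ S Y₁ Y₂) : ℝ :=
  ((Fintype.card M₀ : ℝ) * Fintype.card M₁ * Fintype.card M₂)⁻¹ *
    (∏ i, ch.stateP (ω.s i)) * ∏ i, ch.trans (c.input ω i) (ω.s i) (ω.y₁ i, ω.y₂ i)

/-- The average probability that at least one receiver decodes its message pair wrongly. -/
def errorProb (c : Code n M₀ M₁ M₂ S X Y₁ Y₂) (ch : Channel S X Y₁ Y₂) : ℝ :=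
  prob (c.joint ch) {ω | c.dec₁ ω.y₁ ≠ (ω.m₀, ω.m₁) ∨ c.dec₂ ω.y₂ ≠ (ω.m₀, ω.m₂)}

end Code

/-- Achievability of `(R₀, R₁, R₂, E₁, E₂)` under the input cost function `φ` and budget `Γ`. The
cost constraint holds for every input sequence of positive probability. -/
def Achievable (ch : Channel S X Y₁ Y₂) (φ : X → ℝ≥0) (Γ : ℝ) (R₀ R₁ R₂ E₁ E₂ : ℝ) : Prop :=
  0 ≤ R₀ ∧ 0 ≤ R₁ ∧ 0 ≤ R₂ ∧
  ∀ ε : ℝ, 0 < ε → ∃ N : ℕ, ∀ n : ℕ, N ≤ n →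
    ∃ c : Code n (Msg n R₀) (Msg n R₁) (Msg n R₂) S X Y₁ Y₂,
      (∀ ω, 0 < c.joint ch ω → (1 / n : ℝ) * ∑ i, (φ (c.input ω i) : ℝ) ≤ Γ) ∧
      c.errorProb ch ≤ ε ∧
      (1 / n : ℝ) * mutualInfo (c.joint ch) (fun ω => ω.s) (fun ω => ω.y₁) ≤ E₁ + ε ∧
      (1 / n : ℝ) * mutualInfo (c.joint ch) (fun ω => ω.s) (fun ω => ω.y₂) ≤ E₂ + ε

/-- The joint pmf `P_S(s) P_{W U V X | S}(w, u, v, x | s) P_{Y₁ Y₂ | X S}(y₁, y₂ | x, s)`. -/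
def letterJoint {W U V : Type*} (ch : Channel S X Y₁ Y₂) (P : S → W × U × V × X → ℝ) :
    S × W × U × V × X × Y₁ × Y₂ → ℝ :=
  fun (s, w, u, v, x, y₁, y₂) => ch.stateP s * P s (w, u, v, x) * ch.trans x s (y₁, y₂)

end Channel

section Coordinates

/-! The coordinate random variables of the single-letter joint distribution. -/

variable {S W U V X Y₁ Y₂ : Type*}

/-- The state. -/
def rvS (ω : S × W × U × V × X × Y₁ × Y₂) : S := ω.1
/-- The first auxiliary variable. -/
def rvW (ω : S × W × U × V × X × Y₁ × Y₂) : W := ω.2.1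
/-- The second auxiliary variable. -/
def rvU (ω : S × W × U × V × X × Y₁ × Y₂) : U := ω.2.2.1
/-- The third auxiliary variable. -/
def rvV (ω : S × W × U × V × X × Y₁ × Y₂) : V := ω.2.2.2.1
/-- The channel input. -/
def rvX (ω : S × W × U × V × X × Y₁ × Y₂) : X := ω.2.2.2.2.1
/-- The first channel output. -/
def rvY₁ (ω : S × W × U × V × X × Y₁ × Y₂) : Y₁ := ω.2.2.2.2.2.1
/-- The second channel output. -/
def rvY₂ (ω : S × W × U × V × X × Y₁ × Y₂) : Y₂ := ω.2.2.2.2.2.2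

end Coordinates

end StateMasking

end

/-! For a block code, take at time $i$ the auxiliary variables
$W_i=(M_0,S^n,Y_1^{i-1},Y_{2,i+1}^n)$, $U_i=M_1$, $V_i=M_2$, with a uniform time index absorbed into
$W$. For each message group $C$ (containing $S^n$), Csiszár's identity (`csiszar_sum_identity`) says
that the defect $D_C=H(Y_k^n|C)-\sum_iH(Y_{k,i}|C,Y_1^{i-1},Y_{2,i+1}^n)$ is the same for $k=1,2$,
and `sum_condEntropy_le` gives $D_C\ge 0$. Fano's inequality bounds each rate by a mutual
information of the block given $S^n$ and the messages already decoded. On adding these bounds the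
defects telescope, even where the chain passes from one receiver to the other, and the one that
remains has the favourable sign (`Code.exists_slackFeasible`). The leakage bound follows from
$H(S^n)=nH(S)$ and the concavity of $H(S|Y)$ in the law of $(S,X)$.

This gives the single-letter conditions up to a slack $\delta$, with an alphabet of $W$ that grows
with $n$. Compactness replaces a cardinality bound: the conditions involve only the law $q$ of
$(S,X)$ and the output entropies given $(W,S)$, $(W,U,S)$ and $(W,V,S)$. These numbers form a point
of the fixed compact set `splitHull`, whatever the alphabets (`Code.exists_splitHull_point`). The
conditions are closed, so a limit point satisfies them with $\delta=0$
(`exists_slackFeasible_zero`).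

A point of `splitHull` is a finite decomposition of $q$, indexed by $W$, with two refinements,
indexed by $U$ and $V$. No bound involves $U$ and $V$ jointly, so they can be glued conditionally
independently given $(W,S,X)$ (`exists_letterJoint`, `exists_testChannel`). -/

noncomputable section

namespace StateMasking

/-! ### Entropy on a finite probability space -/

section Toolkit

set_option linter.unusedSectionVars false

variable {Ω A B C D : Type*} [Fintype Ω] [Fintype A] [Fintype B] [Fintype C] [Fintype D]

open Classical in
theorem law_eq_sum (p : Ω → ℝ) (X : Ω → A) (a : A) :
    law p X a = ∑ ω, if X ω = a then p ω else 0 := by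
  simp only [law, prob, Set.mem_ofPred_eq]

theorem law_nonneg {p : Ω → ℝ} (hp : ∀ ω, 0 ≤ p ω) (X : Ω → A) (a : A) : 0 ≤ law p X a := by
  classical
  rw [law_eq_sum]
  exact Finset.sum_nonneg fun ω _ => by split_ifs <;> simp [hp]

theorem le_law {p : Ω → ℝ} (hp : ∀ ω, 0 ≤ p ω) (X : Ω → A) (ω : Ω) : p ω ≤ law p X (X ω) := by
  classical
  rw [law_eq_sum]
  refine le_trans ?_ (Finset.single_le_sum (f := fun ω' => if X ω' = X ω then p ω' else 0)
    (fun ω' _ => ?_) (Finset.mem_univ ω))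
  · simp
  · split_ifs <;> simp [hp]

theorem law_mono {p : Ω → ℝ} (hp : ∀ ω, 0 ≤ p ω) {X : Ω → A} {Y : Ω → B} {a : A} {b : B}
    (h : ∀ ω, X ω = a → Y ω = b) : law p X a ≤ law p Y b := by
  classical
  rw [law_eq_sum, law_eq_sum]
  refine Finset.sum_le_sum fun ω _ => ?_
  by_cases h1 : X ω = a
  · simp [h1, h ω h1]
  · simp only [h1, if_false]; split_ifs <;> simp [hp]

/-- Expectation of a function of a random variable. -/
theorem sum_mul_comp (p : Ω → ℝ) (X : Ω → A) (g : A → ℝ) :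
    ∑ ω, p ω * g (X ω) = ∑ a, law p X a * g a := by
  classical
  simp_rw [law_eq_sum, Finset.sum_mul]
  rw [Finset.sum_comm]
  refine Finset.sum_congr rfl fun ω _ => ?_
  simp [ite_mul]

theorem sum_law (p : Ω → ℝ) (X : Ω → A) : ∑ a, law p X a = ∑ ω, p ω := by
  simpa using (sum_mul_comp p X fun _ => 1).symm

open Classical in
theorem law_comp (p : Ω → ℝ) (X : Ω → A) (f : A → B) (b : B) :
    law p (fun ω => f (X ω)) b = ∑ a, if f a = b then law p X a else 0 := by
  rw [law_eq_sum]
  simpa using sum_mul_comp p X fun a => if f a = b then 1 else 0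

theorem sum_law_pair (p : Ω → ℝ) (X : Ω → A) (Y : Ω → B) (b : B) :
    ∑ a, law p (fun ω => (X ω, Y ω)) (a, b) = law p Y b := by
  classical
  rw [show Y = fun ω => Prod.snd (X ω, Y ω) from rfl, law_comp, Fintype.sum_prod_type]
  simp

theorem entropy_eq_sum (p : Ω → ℝ) (X : Ω → A) :
    entropy p X = -∑ ω, p ω * Real.logb 2 (law p X (X ω)) := by
  rw [entropy, ← sum_mul_comp p X fun a => Real.logb 2 (law p X a)]

/-- The chain rule: outcomes of mass zero drop out, and at all others both laws are positive, so the
logarithm of the quotient splits. -/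
theorem condEntropy_eq {p : Ω → ℝ} (hp : ∀ ω, 0 ≤ p ω) (X : Ω → A) (Y : Ω → B) :
    condEntropy p X Y = entropy p (fun ω => (X ω, Y ω)) - entropy p Y := by
  have h : condEntropy p X Y = -∑ ω, p ω * Real.logb 2
      (law p (fun ω => (X ω, Y ω)) (X ω, Y ω) / law p Y (Y ω)) := by
    have := sum_mul_comp p (fun ω => (X ω, Y ω)) fun z =>
      Real.logb 2 (law p (fun ω => (X ω, Y ω)) z / law p Y z.2)
    rw [condEntropy, this, Fintype.sum_prod_type]
  rw [h, entropy_eq_sum, entropy_eq_sum, neg_sub_neg, neg_eq_iff_eq_neg, neg_sub,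
    ← Finset.sum_sub_distrib]
  refine Finset.sum_congr rfl fun ω _ => ?_
  rcases (hp ω).eq_or_lt with h0 | h0
  · simp [← h0]
  · rw [Real.logb_div, mul_sub]
    · exact (h0.trans_le (le_law hp (fun ω => (X ω, Y ω)) ω)).ne'
    · exact (h0.trans_le (le_law hp Y ω)).ne'

/-- A random variable that is determined by another one has smaller entropy. -/
theorem entropy_mono {p : Ω → ℝ} (hp : ∀ ω, 0 ≤ p ω) {X : Ω → A} {Y : Ω → B}
    (h : ∀ ω ω', X ω = X ω' → Y ω = Y ω') : entropy p Y ≤ entropy p X := by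
  rw [entropy_eq_sum, entropy_eq_sum, neg_le_neg_iff]
  refine Finset.sum_le_sum fun ω _ => ?_
  rcases (hp ω).eq_or_lt with h0 | h0
  · simp [← h0]
  · refine mul_le_mul_of_nonneg_left ?_ h0.le
    exact Real.logb_le_logb_of_le one_lt_two (h0.trans_le (le_law hp X ω))
      (law_mono hp fun ω' h' => h _ _ h')

theorem entropy_congr {p : Ω → ℝ} (hp : ∀ ω, 0 ≤ p ω) {X : Ω → A} {Y : Ω → B}
    (h : ∀ ω ω', X ω = X ω' ↔ Y ω = Y ω') : entropy p X = entropy p Y :=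
  le_antisymm (entropy_mono hp fun ω ω' => (h ω ω').2) (entropy_mono hp fun ω ω' => (h ω ω').1)

/-- Gibbs' inequality for a conditional (sub-)pmf `Q(x | y)`. -/
theorem gibbs {p : Ω → ℝ} (hp : ∀ ω, 0 ≤ p ω) (X : Ω → A) (Y : Ω → B) (Q : A → B → ℝ)
    (hQ : ∀ a b, 0 ≤ Q a b) (hpos : ∀ ω, 0 < p ω → 0 < Q (X ω) (Y ω))
    (hsum : ∀ b, ∑ a, Q a b ≤ 1) :
    entropy p (fun ω => (X ω, Y ω)) - entropy p Y ≤
      -∑ ω, p ω * Real.logb 2 (Q (X ω) (Y ω)) := by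
  set Z : Ω → A × B := fun ω => (X ω, Y ω) with hZ
  -- This is $\log x\le x-1$ at $x=Q(X|Y)P(Y)/P(X,Y)$, weighted by `p ω`. Summed over `ω`, the right
  -- side is nonpositive because $Q(\cdot|y)$ has mass at most one.
  have key : ∀ ω, p ω * (Real.logb 2 (Q (X ω) (Y ω)) + Real.logb 2 (law p Y (Y ω)) -
      Real.logb 2 (law p Z (Z ω))) ≤
      (p ω * (Q (X ω) (Y ω) * law p Y (Y ω) / law p Z (Z ω)) - p ω) / Real.log 2 := by
    intro ω
    rcases (hp ω).eq_or_lt with h0 | h0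
    · simp [← h0]
    have h1 := hpos ω h0
    have h2 := h0.trans_le (le_law hp Y ω)
    have h3 := h0.trans_le (le_law hp Z ω)
    rw [← Real.logb_mul h1.ne' h2.ne', ← Real.logb_div (mul_pos h1 h2).ne' h3.ne',
      ← mul_sub_one, mul_div_assoc (p ω)]
    refine mul_le_mul_of_nonneg_left ?_ h0.le
    rw [Real.logb]
    have := Real.log_pos one_lt_two
    gcongr
    exact Real.log_le_sub_one_of_pos (by positivity)
  have hs : ∑ ω, p ω * (Q (X ω) (Y ω) * law p Y (Y ω) / law p Z (Z ω)) ≤ ∑ ω, p ω := by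
    rw [sum_mul_comp p Z fun z => Q z.1 z.2 * law p Y z.2 / law p Z z]
    calc _ ≤ ∑ z : A × B, Q z.1 z.2 * law p Y z.2 := by
          refine Finset.sum_le_sum fun z _ => ?_
          rcases (law_nonneg hp Z z).eq_or_lt with h0 | h0
          · rw [← h0]; simpa using mul_nonneg (hQ _ _) (law_nonneg hp _ _)
          · rw [mul_div_cancel₀ _ h0.ne']
      _ = ∑ b, (∑ a, Q a b) * law p Y b := by
          rw [Fintype.sum_prod_type_right]
          simp_rw [Finset.sum_mul]
      _ ≤ ∑ b, 1 * law p Y b := Finset.sum_le_sum fun b _ =>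
          mul_le_mul_of_nonneg_right (hsum b) (law_nonneg hp _ _)
      _ = ∑ ω, p ω := by simp [sum_law]
  have hfin := Finset.sum_le_sum fun ω (_ : ω ∈ Finset.univ) => key ω
  rw [← Finset.sum_div, Finset.sum_sub_distrib] at hfin
  have h0 : (∑ ω, p ω * (Q (X ω) (Y ω) * law p Y (Y ω) / law p Z (Z ω)) - ∑ ω, p ω) /
      Real.log 2 ≤ 0 :=
    div_nonpos_of_nonpos_of_nonneg (by linarith) (Real.log_pos one_lt_two).le
  simp_rw [mul_sub, mul_add, Finset.sum_sub_distrib, Finset.sum_add_distrib] at hfin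
  rw [entropy_eq_sum, entropy_eq_sum]
  linarith

/-- Gibbs' inequality with the test law $Q(x|y,z)=P(x|z)$, whose cross entropy is exactly $H(X|Z)$.
The total mass of `p` need not be one. -/
theorem entropy_submodular_triple {p : Ω → ℝ} (hp : ∀ ω, 0 ≤ p ω) (X : Ω → A) (Y : Ω → B)
    (Z : Ω → C) :
    entropy p (fun ω => (X ω, Y ω, Z ω)) + entropy p Z ≤
      entropy p (fun ω => (X ω, Z ω)) + entropy p (fun ω => (Y ω, Z ω)) := by
  have h := gibbs hp X (fun ω => (Y ω, Z ω))
    (fun a b => law p (fun ω => (X ω, Z ω)) (a, b.2) / law p Z b.2)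
    (fun a b => div_nonneg (law_nonneg hp _ _) (law_nonneg hp _ _))
    (fun ω h0 => div_pos (h0.trans_le (le_law hp (fun ω => (X ω, Z ω)) ω))
      (h0.trans_le (le_law hp Z ω)))
    (fun b => by rw [← Finset.sum_div, sum_law_pair]; exact div_self_le_one _)
  have h2 : -∑ ω, p ω * Real.logb 2 (law p (fun ω => (X ω, Z ω)) (X ω, Z ω) / law p Z (Z ω)) =
      entropy p (fun ω => (X ω, Z ω)) - entropy p Z := by
    rw [entropy_eq_sum, entropy_eq_sum, neg_sub_neg, neg_eq_iff_eq_neg, neg_sub,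
      ← Finset.sum_sub_distrib]
    refine Finset.sum_congr rfl fun ω _ => ?_
    rcases (hp ω).eq_or_lt with h0 | h0
    · simp [← h0]
    · rw [Real.logb_div, mul_sub]
      · exact (h0.trans_le (le_law hp (fun ω => (X ω, Z ω)) ω)).ne'
      · exact (h0.trans_le (le_law hp Z ω)).ne'
  linarith

/-- Submodularity of entropy: `R` is determined by `(X, Y)`, and `T` both by `X` and by `Y`. -/
theorem entropy_submodular {p : Ω → ℝ} (hp : ∀ ω, 0 ≤ p ω) {X : Ω → A} {Y : Ω → B} {R : Ω → C}
    {T : Ω → D} (hR : ∀ ω ω', X ω = X ω' → Y ω = Y ω' → R ω = R ω')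
    (hX : ∀ ω ω', X ω = X ω' → T ω = T ω') (hY : ∀ ω ω', Y ω = Y ω' → T ω = T ω') :
    entropy p R + entropy p T ≤ entropy p X + entropy p Y := by
  have h1 := entropy_submodular_triple hp X Y T
  have h2 : entropy p (fun ω => (X ω, T ω)) ≤ entropy p X :=
    entropy_mono hp fun ω ω' h => by simp [h, hX _ _ h]
  have h3 : entropy p (fun ω => (Y ω, T ω)) ≤ entropy p Y :=
    entropy_mono hp fun ω ω' h => by simp [h, hY _ _ h]
  have h4 : entropy p R ≤ entropy p (fun ω => (X ω, Y ω, T ω)) :=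
    entropy_mono hp fun ω ω' h => by
      simp only [Prod.mk.injEq] at h
      exact hR _ _ h.1 h.2.1
  linarith

theorem entropy_unit {p : Ω → ℝ} (hp1 : ∑ ω, p ω = 1) :
    entropy p (fun _ => ()) = 0 := by
  rw [entropy_eq_sum]
  simp [law_eq_sum, hp1]

theorem entropy_pair_le {p : Ω → ℝ} (hp : ∀ ω, 0 ≤ p ω) (hp1 : ∑ ω, p ω = 1) (X : Ω → A)
    (Y : Ω → B) : entropy p (fun ω => (X ω, Y ω)) ≤ entropy p X + entropy p Y := by
  have := entropy_submodular hp (X := X) (Y := Y) (R := fun ω => (X ω, Y ω)) (T := fun _ => ())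
    (by simp +contextual) (by simp) (by simp)
  rw [entropy_unit hp1] at this
  linarith

theorem entropy_le_card {p : Ω → ℝ} (hp : ∀ ω, 0 ≤ p ω) (hp1 : ∑ ω, p ω = 1) (X : Ω → A) :
    entropy p X ≤ Real.logb 2 (Fintype.card A) := by
  have hne : Nonempty Ω := by
    by_contra h
    rw [not_nonempty_iff] at h
    simp at hp1
  have : Nonempty A := hne.map X
  have hc : (0 : ℝ) < Fintype.card A := by exact_mod_cast Fintype.card_pos
  have h := gibbs hp X (fun _ => ()) (fun _ _ => (Fintype.card A : ℝ)⁻¹)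
    (fun _ _ => by positivity) (fun _ _ => by positivity)
    (fun _ => by simp [hc.ne'])
  rw [entropy_unit hp1, ← Finset.sum_mul, hp1, Real.logb_inv] at h
  have h2 : entropy p (fun ω => (X ω, ())) = entropy p X := entropy_congr hp (by simp)
  rw [h2] at h
  linarith

/-- Fano's inequality. -/
theorem fano {p : Ω → ℝ} (hp : ∀ ω, 0 ≤ p ω) (hp1 : ∑ ω, p ω = 1) (X : Ω → A) (Y : Ω → B)
    (g : B → A) {ε : ℝ} (hε : prob p {ω | g (Y ω) ≠ X ω} ≤ ε) :
    entropy p (fun ω => (X ω, Y ω)) - entropy p Y ≤ 1 + ε * Real.logb 2 (Fintype.card A) := by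
  classical
  have hne : Nonempty Ω := by
    by_contra h
    rw [not_nonempty_iff] at h
    simp at hp1
  have : Nonempty A := hne.map X
  have hc : (1 : ℝ) ≤ Fintype.card A := by exact_mod_cast Fintype.card_pos
  have hc0 : (0 : ℝ) < Fintype.card A := by linarith
  -- The test law puts mass 1/2 on the estimate and spreads 1/2 uniformly over `A`. It costs one bit
  -- when the estimate is right and $1+\log|A|$ bits when it is wrong, so no binary entropy function
  -- is needed.
  have h := gibbs hp X Y (fun a b => if g b = a then 2⁻¹ else (2 * (Fintype.card A : ℝ))⁻¹)
    (fun a b => by split_ifs <;> positivity) (fun a b => by split_ifs <;> positivity)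
    (fun b => by
      calc ∑ a, (if g b = a then (2 : ℝ)⁻¹ else (2 * (Fintype.card A : ℝ))⁻¹)
          ≤ ∑ a, ((if g b = a then (2 : ℝ)⁻¹ else 0) + (2 * (Fintype.card A : ℝ))⁻¹) := by
            refine Finset.sum_le_sum fun a _ => ?_
            split_ifs
            · simp
            · simp
        _ = 1 := by
            rw [Finset.sum_add_distrib]
            simp
            field_simp
            norm_num)
  refine h.trans ?_
  have hl : 0 ≤ Real.logb 2 (Fintype.card A) := Real.logb_nonneg one_lt_two hc
  have h2 : -∑ ω, p ω * Real.logb 2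
      (if g (Y ω) = X ω then 2⁻¹ else (2 * (Fintype.card A : ℝ))⁻¹) =
      1 + prob p {ω | g (Y ω) ≠ X ω} * Real.logb 2 (Fintype.card A) := by
    rw [prob, Finset.sum_mul, ← hp1, ← Finset.sum_neg_distrib, ← Finset.sum_add_distrib]
    refine Finset.sum_congr rfl fun ω _ => ?_
    by_cases h1 : g (Y ω) = X ω
    · simp [h1, Real.logb_inv]
    · simp only [h1, if_false, Set.mem_ofPred_eq, ne_eq, not_false_eq_true, if_true]
      rw [Real.logb_inv, Real.logb_mul two_ne_zero hc0.ne', Real.logb_self_eq_one one_lt_two]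
      ring
  rw [h2]
  gcongr

end Toolkit

/-! ### Conditional entropy as a homogeneous functional of unnormalized measures -/

section Functional

set_option linter.unusedSectionVars false

variable {Ω A B C J : Type*} [Fintype Ω] [Fintype A] [Fintype B] [Fintype C] [Fintype J]

/-- The function `-x log₂ x`. -/
def negMulLog2 (x : ℝ) : ℝ := Real.negMulLog x / Real.log 2

theorem negMulLog2_eq (x : ℝ) : negMulLog2 x = -(x * Real.logb 2 x) := by
  rw [negMulLog2, Real.negMulLog, Real.logb]; ring

theorem negMulLog2_mul (x y : ℝ) :
    negMulLog2 (x * y) = y * negMulLog2 x + x * negMulLog2 y := by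
  simp only [negMulLog2, Real.negMulLog_mul]; ring

@[fun_prop] theorem continuous_negMulLog2 : Continuous negMulLog2 :=
  Real.continuous_negMulLog.div_const _

theorem entropy_eq_negMulLog2 (p : Ω → ℝ) (X : Ω → A) :
    entropy p X = ∑ a, negMulLog2 (law p X a) := by
  simp [entropy, negMulLog2_eq]

/-- The conditional entropy of the first coordinate given the second one, as a function of a
joint measure that need not be normalized. -/
def ce (ρ : A → B → ℝ) : ℝ :=
  ∑ b, (∑ a, negMulLog2 (ρ a b) - negMulLog2 (∑ a, ρ a b))

theorem condEntropy_eq_ce {p : Ω → ℝ} (hp : ∀ ω, 0 ≤ p ω) (X : Ω → A) (Y : Ω → B) :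
    condEntropy p X Y = ce fun a b => law p (fun ω => (X ω, Y ω)) (a, b) := by
  rw [condEntropy_eq hp, entropy_eq_negMulLog2, entropy_eq_negMulLog2, ce,
    Finset.sum_sub_distrib, Fintype.sum_prod_type_right]
  simp_rw [sum_law_pair]

/-- The terms with `negMulLog2 c` cancel between joint and marginal. Homogeneity lets the weight of
a conditional law be absorbed into the measure, so averages become plain sums. -/
theorem ce_smul (c : ℝ) (ρ : A → B → ℝ) : ce (fun a b => c * ρ a b) = c * ce ρ := by
  simp only [ce, negMulLog2_mul, ← Finset.mul_sum, Finset.sum_add_distrib]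
  rw [Finset.mul_sum]
  refine Finset.sum_congr rfl fun b _ => ?_
  rw [← Finset.sum_mul]
  ring

@[fun_prop] theorem continuous_ce : Continuous (ce : (A → B → ℝ) → ℝ) := by
  unfold ce
  fun_prop

/-- Conditioning reduces entropy. -/
theorem sum_ce_le {ρ : J → A → B → ℝ} (hρ : ∀ j a b, 0 ≤ ρ j a b) :
    ∑ j, ce (ρ j) ≤ ce (fun a b => ∑ j, ρ j a b) := by
  classical
  -- The family is read as one measure on `J × A × B`; submodularity then compares conditioning on
  -- `(j, b)` with conditioning on `b`.
  set p : J × A × B → ℝ := fun z => ρ z.1 z.2.1 z.2.2 with hpdef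
  have hp : ∀ z, 0 ≤ p z := fun z => hρ _ _ _
  have h := entropy_submodular_triple hp (fun z => z.2.1) (fun z => z.1) (fun z => z.2.2)
  have h1 : ce (fun a b => ∑ j, ρ j a b) =
      entropy p (fun z => (z.2.1, z.2.2)) - entropy p (fun z => z.2.2) := by
    rw [← condEntropy_eq hp, condEntropy_eq_ce hp]
    congr 1; ext a b
    rw [law_eq_sum, Fintype.sum_prod_type]
    refine Finset.sum_congr rfl fun j _ => ?_
    rw [Finset.sum_eq_single (a, b)] <;> simp +contextual [p]
  have h2 : ∑ j, ce (ρ j) = entropy p (fun z => (z.2.1, z.1, z.2.2)) -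
      entropy p (fun z => (z.1, z.2.2)) := by
    rw [← condEntropy_eq hp, condEntropy_eq_ce hp]
    simp only [ce]
    rw [Fintype.sum_prod_type]
    have : ∀ j a b, law p (fun ω => (ω.2.1, ω.1, ω.2.2)) (a, j, b) = ρ j a b := by
      intro j a b
      rw [law_eq_sum, Finset.sum_eq_single (j, a, b)]
      · simp [p]
      · rintro ⟨j', a', b'⟩ _ hne
        rw [if_neg]
        rintro ⟨⟩
        exact hne rfl
      · simp
    simp_rw [this]
  linarith

end Functional

/-! ### Compact convex hulls that encode decompositions and their refinements -/

section Hull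

set_option linter.unusedSectionVars false

variable {ι F : Type*} [Fintype ι] [NormedAddCommGroup F] [NormedSpace ℝ F]

/-- The sum is a convex combination, with weights `l j`, of the normalized vectors; indices of
weight zero contribute nothing. -/
theorem sum_mem_of_inv_smul_mem {J G : Type*} [Fintype J] [AddCommGroup G] [Module ℝ G]
    {K : Set G} (hK : Convex ℝ K) (l : J → ℝ) (v : J → G) (hl : ∀ j, 0 ≤ l j)
    (hl1 : ∑ j, l j = 1) (hv : ∀ j, 0 < l j → (l j)⁻¹ • v j ∈ K)
    (hv0 : ∀ j, l j = 0 → v j = 0) : ∑ j, v j ∈ K := by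
  classical
  have h1 : ∑ j, v j = ∑ j ∈ Finset.univ.filter (fun j => 0 < l j), l j • ((l j)⁻¹ • v j) := by
    rw [Finset.sum_filter]
    refine Finset.sum_congr rfl fun j _ => ?_
    rcases (hl j).eq_or_lt with h | h
    · simp [hv0 j h.symm, ← h]
    · rw [if_pos h, smul_smul, mul_inv_cancel₀ h.ne', one_smul]
  rw [h1]
  refine hK.sum_mem (fun j _ => hl j) ?_ fun j hj => hv j (Finset.mem_filter.1 hj).2
  rw [← hl1, Finset.sum_filter]
  refine Finset.sum_congr rfl fun j _ => ?_
  split_ifs with h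
  · rfl
  · exact le_antisymm (hl j) (not_lt.1 h)

/-- In finite dimension the convex hull of a compact set is compact. -/
theorem isCompact_convexHull_of_isCompact {G : Type*} [NormedAddCommGroup G] [NormedSpace ℝ G]
    [FiniteDimensional ℝ G] {K : Set G} (hK : IsCompact K) : IsCompact (convexHull ℝ K) := by
  classical
  rcases K.eq_empty_or_nonempty with rfl | ⟨k₀, hk₀⟩
  · simp
  -- By Carathéodory, dimension plus one points suffice, so the hull is a continuous image of a
  -- simplex times a power of `K`. Shorter combinations are padded with weight zero at `k₀`.
  set d := Module.finrank ℝ G + 1 with hd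
  have hc : IsCompact (stdSimplex ℝ (Fin d) ×ˢ Set.univ.pi fun _ : Fin d => K) :=
    (isCompact_stdSimplex ℝ (Fin d)).prod (isCompact_univ_pi fun _ => hK)
  have himg := hc.image (f := fun z : (Fin d → ℝ) × (Fin d → G) => ∑ i, z.1 i • z.2 i)
    (by fun_prop)
  convert himg using 1
  ext x
  constructor
  · intro hx
    obtain ⟨κ, _, y, w, hy, haff, hw, hw1, hs⟩ := eq_pos_convex_span_of_mem_convexHull hx
    have hcard : Fintype.card κ ≤ d := haff.card_le_finrank_succ.trans
      (Nat.succ_le_succ (Submodule.finrank_le _))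
    obtain ⟨e⟩ : Nonempty (κ ↪ Fin d) := Function.Embedding.nonempty_of_card_le (by simpa)
    refine ⟨(Function.extend e w 0, Function.extend e y fun _ => k₀), ⟨⟨fun i => ?_, ?_⟩, ?_⟩, ?_⟩
    · by_cases hi : ∃ k, e k = i
      · obtain ⟨k, rfl⟩ := hi
        simpa [e.injective.extend_apply] using (hw k).le
      · simp [Function.extend_apply' _ _ _ hi]
    · rw [← hw1]
      dsimp only
      rw [← Finset.sum_subset (Finset.subset_univ (Finset.univ.map e))]
      · simp [e.injective.extend_apply]
      · intro i _ hi
        rw [Function.extend_apply']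
        · rfl
        · simpa using hi
    · intro i _
      by_cases hi : ∃ k, e k = i
      · obtain ⟨k, rfl⟩ := hi
        simpa [e.injective.extend_apply] using hy ⟨k, rfl⟩
      · simpa [Function.extend_apply' _ _ _ hi] using hk₀
    · rw [← hs]
      dsimp only
      rw [← Finset.sum_subset (Finset.subset_univ (Finset.univ.map e))]
      · simp [e.injective.extend_apply]
      · intro i _ hi
        rw [Function.extend_apply' w]
        · simp
        · simpa using hi
  · rintro ⟨⟨w, y⟩, ⟨hw, hy⟩, rfl⟩
    exact (convex_convexHull ℝ K).sum_mem (fun i _ => hw.1 i) hw.2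
      fun i _ => subset_convexHull ℝ K (hy i (Set.mem_univ i))

/-- The convex hull of the graph of `f` over the probability simplex. -/
def graphHull (f : (ι → ℝ) → F) : Set ((ι → ℝ) × F) :=
  convexHull ℝ ((fun q => (q, f q)) '' stdSimplex ℝ ι)

/-- Two points of the graph hull over a common base point, together with the graph point. -/
def graphPairs (f : (ι → ℝ) → F) : Set ((ι → ℝ) × F × F × F) :=
  (fun z : ((ι → ℝ) × F) × (ι → ℝ) × F => (z.1.1, f z.1.1, z.1.2, z.2.2)) ''
    ((graphHull f ×ˢ graphHull f) ∩ {z | z.1.1 = z.2.1})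

/-- The values of the averages of `f` under a decomposition of a pmf and under two refinements of
this decomposition. -/
def splitHull (f : (ι → ℝ) → F) : Set ((ι → ℝ) × F × F × F) :=
  convexHull ℝ (graphPairs f)

theorem isCompact_splitHull [FiniteDimensional ℝ F] {f : (ι → ℝ) → F} (hf : Continuous f) :
    IsCompact (splitHull f) := by
  have h0 : IsCompact ((fun q => (q, f q)) '' stdSimplex ℝ ι) :=
    (isCompact_stdSimplex ℝ ι).image (by fun_prop)
  have h1 : IsCompact (graphHull f) := isCompact_convexHull_of_isCompact h0
  refine isCompact_convexHull_of_isCompact ?_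
  refine ((h1.prod h1).inter_right ?_).image (by fun_prop)
  exact isClosed_eq (by fun_prop) (by fun_prop)

variable {f : (ι → ℝ) → F}

theorem smul_mem_stdSimplex {q : ι → ℝ} (hq : ∀ i, 0 ≤ q i) (h : 0 < ∑ i, q i) :
    (∑ i, q i)⁻¹ • q ∈ stdSimplex ℝ ι := by
  refine ⟨fun i => mul_nonneg (inv_nonneg.2 h.le) (hq i), ?_⟩
  simp only [Pi.smul_apply, smul_eq_mul]
  rw [← Finset.mul_sum, inv_mul_cancel₀ h.ne']

theorem eq_zero_of_sum_eq_zero {q : ι → ℝ} (hq : ∀ i, 0 ≤ q i) (h : ∑ i, q i = 0) : q = 0 := by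
  ext i
  exact (Finset.sum_eq_zero_iff_of_nonneg fun i _ => hq i).1 h i (Finset.mem_univ i)

theorem map_zero_of_homogeneous (hh : ∀ (c : ℝ) q, f (c • q) = c • f q) : f 0 = 0 := by
  simpa using hh 0 0

theorem sum_mem_graphHull {J : Type*} [Fintype J] (hh : ∀ (c : ℝ) q, f (c • q) = c • f q)
    (r : J → ι → ℝ) (hr : ∀ j i, 0 ≤ r j i) (h1 : ∑ j, ∑ i, r j i = 1) :
    (∑ j, r j, ∑ j, f (r j)) ∈ graphHull f := by
  have := sum_mem_of_inv_smul_mem (convex_convexHull ℝ ((fun q => (q, f q)) '' stdSimplex ℝ ι))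
    (fun j => ∑ i, r j i) (fun j => (r j, f (r j))) (fun j => Finset.sum_nonneg fun i _ => hr j i)
    h1 (fun j hj => subset_convexHull ℝ _ ⟨_, smul_mem_stdSimplex (hr j) hj, by simp [hh]⟩)
    (fun j hj => by
      rw [eq_zero_of_sum_eq_zero (hr j) hj, map_zero_of_homogeneous hh]; rfl)
  have e : (∑ j, r j, ∑ j, f (r j)) = ∑ j, (r j, f (r j)) := by
    simp [Prod.ext_iff, Prod.fst_sum, Prod.snd_sum]
  rw [e]
  exact this

theorem inv_smul_mem_graphHull {J : Type*} [Fintype J] (hh : ∀ (c : ℝ) q, f (c • q) = c • f q)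
    {q : ι → ℝ} (r : J → ι → ℝ) (hr : ∀ j i, 0 ≤ r j i) (hs : ∑ j, r j = q)
    (hq : 0 < ∑ i, q i) :
    ((∑ i, q i)⁻¹ • q, (∑ i, q i)⁻¹ • ∑ j, f (r j)) ∈ graphHull f := by
  have := sum_mem_graphHull hh (fun j => (∑ i, q i)⁻¹ • r j)
    (fun j i => mul_nonneg (inv_nonneg.2 hq.le) (hr j i)) (by
      simp only [Pi.smul_apply, smul_eq_mul, ← Finset.mul_sum]
      rw [Finset.sum_comm, ← inv_mul_cancel₀ hq.ne', ← hs]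
      simp [Finset.sum_apply])
  simpa only [hh, ← Finset.smul_sum, hs] using this

theorem sum_map_eq_zero {J : Type*} [Fintype J] (hh : ∀ (c : ℝ) q, f (c • q) = c • f q)
    (r : J → ι → ℝ) (hr : ∀ j i, 0 ≤ r j i) (hs : ∑ j, r j = 0) : ∑ j, f (r j) = 0 := by
  refine Finset.sum_eq_zero fun j _ => ?_
  have : r j = 0 := by
    ext i
    have h2 := congrFun hs i
    rw [Finset.sum_apply] at h2
    exact (Finset.sum_eq_zero_iff_of_nonneg fun j _ => hr j i).1 h2 j (Finset.mem_univ j)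
  rw [this, map_zero_of_homogeneous hh]

/-- For each `j` of positive mass, normalizing by that mass turns the two refinements into
graph-hull points over the same base point. The masses then serve as weights of the outer convex
combination. -/
theorem sum_mem_splitHull {J U V : Type*} [Fintype J] [Fintype U] [Fintype V]
    (hh : ∀ (c : ℝ) q, f (c • q) = c • f q) (t : J → ι → ℝ)
    (r : J → U → ι → ℝ) (r' : J → V → ι → ℝ) (hr : ∀ j u i, 0 ≤ r j u i)
    (hr' : ∀ j v i, 0 ≤ r' j v i) (ht : ∀ j, ∑ u, r j u = t j) (ht' : ∀ j, ∑ v, r' j v = t j)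
    (h1 : ∑ j, ∑ i, t j i = 1) :
    (∑ j, t j, ∑ j, f (t j), ∑ j, ∑ u, f (r j u), ∑ j, ∑ v, f (r' j v)) ∈ splitHull f := by
  have ht0 : ∀ j i, 0 ≤ t j i := fun j i => by
    rw [← ht, Finset.sum_apply]; exact Finset.sum_nonneg fun u _ => hr j u i
  have := sum_mem_of_inv_smul_mem (convex_convexHull ℝ (graphPairs f))
    (fun j => ∑ i, t j i)
    (fun j => (t j, f (t j), ∑ u, f (r j u), ∑ v, f (r' j v)))
    (fun j => Finset.sum_nonneg fun i _ => ht0 j i) h1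
    (fun j hj => subset_convexHull ℝ _ ⟨((_, _), (_, _)),
      ⟨⟨inv_smul_mem_graphHull hh (r j) (hr j) (ht j) hj,
        inv_smul_mem_graphHull hh (r' j) (hr' j) (ht' j) hj⟩, rfl⟩, by simp [hh]⟩)
    (fun j hj => by
      have h0 := eq_zero_of_sum_eq_zero (ht0 j) hj
      rw [sum_map_eq_zero hh (r j) (hr j) ((ht j).trans h0),
        sum_map_eq_zero hh (r' j) (hr' j) ((ht' j).trans h0), h0, map_zero_of_homogeneous hh]
      rfl)
  have e : (∑ j, t j, ∑ j, f (t j), ∑ j, ∑ u, f (r j u), ∑ j, ∑ v, f (r' j v)) =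
      ∑ j, (t j, f (t j), ∑ u, f (r j u), ∑ v, f (r' j v)) := by
    simp [Prod.ext_iff, Prod.fst_sum, Prod.snd_sum]
  rw [e]
  exact this

theorem exists_of_mem_graphHull (hh : ∀ (c : ℝ) q, f (c • q) = c • f q) {z : (ι → ℝ) × F}
    (hz : z ∈ graphHull f) :
    ∃ (n : ℕ) (r : Fin n → ι → ℝ), (∀ j i, 0 ≤ r j i) ∧ ∑ j, r j = z.1 ∧ ∑ j, f (r j) = z.2 := by
  obtain ⟨κ, _, w, y, hw, hw1, hy, hs⟩ := mem_convexHull_iff_exists_fintype.1 hz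
  choose q hq hqy using hy
  let e := Fintype.equivFin κ
  refine ⟨Fintype.card κ, fun j => w (e.symm j) • q (e.symm j),
    fun j i => mul_nonneg (hw _) ((hq _).1 i), ?_, ?_⟩
  · rw [e.symm.sum_comp fun k => w k • q k, ← hs]
    simp [Prod.fst_sum, ← hqy]
  · simp only [hh]
    rw [e.symm.sum_comp fun k => w k • f (q k), ← hs]
    simp [Prod.snd_sum, ← hqy]

/-- Finite families of possibly different lengths, extended by zero to a common length. -/
theorem exists_common_length {n : ℕ} (hh : ∀ (c : ℝ) q, f (c • q) = c • f q) (m : Fin n → ℕ)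
    (r : (j : Fin n) → Fin (m j) → ι → ℝ) (hr : ∀ j u i, 0 ≤ r j u i) :
    ∃ (b : ℕ) (r' : Fin n → Fin b → ι → ℝ), (∀ j u i, 0 ≤ r' j u i) ∧
      (∀ j, ∑ u, r' j u = ∑ u, r j u) ∧ ∀ j, ∑ u, f (r' j u) = ∑ u, f (r j u) := by
  have h0 := map_zero_of_homogeneous hh
  have hm : ∀ j, m j ≤ ∑ j, m j := fun j =>
    Finset.single_le_sum (f := m) (fun _ _ => Nat.zero_le _) (Finset.mem_univ j)
  -- The sum of all lengths is a crude common bound; the padding is harmless because `f 0 = 0`.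
  refine ⟨∑ j, m j, fun j u => if h : u.1 < m j then r j ⟨u, h⟩ else 0, fun j u i => ?_,
    fun j => ?_, fun j => ?_⟩
  · dsimp only
    split_ifs
    · exact hr _ _ _
    · rfl
  · rw [← Finset.sum_subset (Finset.subset_univ (Finset.univ.map (Fin.castLEEmb (hm j))))]
    · simp
    · intro u _ hu
      refine dif_neg ?_
      intro h
      exact hu (Finset.mem_map.2 ⟨⟨u, h⟩, Finset.mem_univ _, rfl⟩)
  · rw [← Finset.sum_subset (Finset.subset_univ (Finset.univ.map (Fin.castLEEmb (hm j))))]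
    · simp
    · intro u _ hu
      refine (congrArg f (dif_neg ?_)).trans h0
      intro h
      exact hu (Finset.mem_map.2 ⟨⟨u, h⟩, Finset.mem_univ _, rfl⟩)

/-- Converse of `sum_mem_splitHull`: homogeneity absorbs the convex weights into the measures. The
refinements, whose lengths depend on `j`, are padded to common index sets, which later become the
alphabets of `U` and `V`. -/
theorem exists_of_mem_splitHull (hh : ∀ (c : ℝ) q, f (c • q) = c • f q)
    {z : (ι → ℝ) × F × F × F} (hz : z ∈ splitHull f) :
    ∃ (a b c : ℕ) (t : Fin a → ι → ℝ) (r : Fin a → Fin b → ι → ℝ) (r' : Fin a → Fin c → ι → ℝ),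
      (∀ j u i, 0 ≤ r j u i) ∧ (∀ j v i, 0 ≤ r' j v i) ∧
      (∀ j, ∑ u, r j u = t j) ∧ (∀ j, ∑ v, r' j v = t j) ∧
      z = (∑ j, t j, ∑ j, f (t j), ∑ j, ∑ u, f (r j u), ∑ j, ∑ v, f (r' j v)) := by
  obtain ⟨κ, _, w, y, hw, hw1, hy, hs⟩ := mem_convexHull_iff_exists_fintype.1 hz
  choose z' hz' hzy using hy
  choose m r hr hrs hrf using fun k => exists_of_mem_graphHull hh (hz' k).1.1
  choose m' r' hr' hrs' hrf' using fun k => exists_of_mem_graphHull hh (hz' k).1.2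
  let e := (Fintype.equivFin κ).symm
  obtain ⟨b, ρ, hρ, hρs, hρf⟩ := exists_common_length hh (fun j => m (e j))
    (fun j u => w (e j) • r (e j) u) fun j u i => mul_nonneg (hw _) (hr _ _ _)
  obtain ⟨c, ρ', hρ', hρs', hρf'⟩ := exists_common_length hh (fun j => m' (e j))
    (fun j u => w (e j) • r' (e j) u) fun j u i => mul_nonneg (hw _) (hr' _ _ _)
  refine ⟨Fintype.card κ, b, c, fun j => w (e j) • (z' (e j)).1.1, ρ, ρ', hρ, hρ',
    fun j => ?_, fun j => ?_, ?_⟩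
  · rw [hρs, ← Finset.smul_sum, hrs]
  · rw [hρs', ← Finset.smul_sum, hrs', ← (hz' (e j)).2]
  · simp only [hρf, hρf', hh, ← Finset.smul_sum, hrf, hrf']
    rw [e.sum_comp fun k => w k • (z' k).1.1, e.sum_comp fun k => w k • f (z' k).1.1,
      e.sum_comp fun k => w k • (z' k).1.2, e.sum_comp fun k => w k • (z' k).2.2, ← hs]
    simp [Prod.ext_iff, Prod.fst_sum, Prod.snd_sum, ← hzy]

end Hull

/-! ### Single-letter entropies as functions of the state-input measure -/

section Kernels

set_option linter.unusedSectionVars false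

variable {S X Y B J : Type*} [Fintype S] [Fintype X] [Fintype Y] [Fintype B] [Fintype J]

open Classical in
/-- The marginal of a transition function along `π`. -/
def marginalKernel (π : B → Y) (τ : X → S → B → ℝ) (x : X) (s : S) (y : Y) : ℝ :=
  ∑ b, if π b = y then τ x s b else 0

/-- `H(Y | S)` for the state-input measure `q`. -/
def outH (T : X → S → Y → ℝ) (q : S × X → ℝ) : ℝ :=
  ce fun y s => ∑ x, q (s, x) * T x s y

/-- `H(S | Y)` for the state-input measure `q`. -/
def inH (T : X → S → Y → ℝ) (q : S × X → ℝ) : ℝ :=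
  ce fun s y => ∑ x, q (s, x) * T x s y

/-- `H(Y | X, S)` for the state-input measure `q`. -/
def noiseH (T : X → S → Y → ℝ) (q : S × X → ℝ) : ℝ :=
  ∑ z, q z * ∑ y, negMulLog2 (T z.2 z.1 y)

variable (T : X → S → Y → ℝ)

theorem outH_smul (c : ℝ) (q : S × X → ℝ) : outH T (c • q) = c * outH T q := by
  simp only [outH, ← ce_smul, Pi.smul_apply, smul_eq_mul, mul_assoc, Finset.mul_sum]

theorem inH_smul (c : ℝ) (q : S × X → ℝ) : inH T (c • q) = c * inH T q := by
  simp only [inH, ← ce_smul, Pi.smul_apply, smul_eq_mul, mul_assoc, Finset.mul_sum]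

@[fun_prop] theorem continuous_outH : Continuous (outH T) :=
  continuous_ce.comp (by fun_prop)

@[fun_prop] theorem continuous_inH : Continuous (inH T) :=
  continuous_ce.comp (by fun_prop)

@[fun_prop] theorem continuous_noiseH : Continuous (noiseH T) := by
  unfold noiseH; fun_prop

variable {T}

/-- With homogeneity, this superadditivity is concavity in the state-input law; it replaces Jensen's
inequality over time. -/
theorem sum_outH_le (hT : ∀ x s y, 0 ≤ T x s y) {q : J → S × X → ℝ} (hq : ∀ j z, 0 ≤ q j z) :
    ∑ j, outH T (q j) ≤ outH T (∑ j, q j) := by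
  refine (sum_ce_le fun j y s => Finset.sum_nonneg fun x _ =>
    mul_nonneg (hq j _) (hT x s y)).trans_eq ?_
  simp only [outH, Finset.sum_apply, Finset.sum_mul]
  congr 1; ext y s
  exact Finset.sum_comm

theorem sum_inH_le (hT : ∀ x s y, 0 ≤ T x s y) {q : J → S × X → ℝ} (hq : ∀ j z, 0 ≤ q j z) :
    ∑ j, inH T (q j) ≤ inH T (∑ j, q j) := by
  refine (sum_ce_le fun j s y => Finset.sum_nonneg fun x _ =>
    mul_nonneg (hq j _) (hT x s y)).trans_eq ?_
  simp only [inH, Finset.sum_apply, Finset.sum_mul]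
  congr 1; ext s y
  exact Finset.sum_comm

variable {τ : X → S → B → ℝ} (π : B → Y)

theorem marginalKernel_nonneg (hτ : ∀ x s, τ x s ∈ stdSimplex ℝ B) (x : X) (s : S) (y : Y) :
    0 ≤ marginalKernel π τ x s y := by
  classical
  exact Finset.sum_nonneg fun b _ => by split_ifs <;> simp [(hτ x s).1]

theorem sum_marginalKernel (hτ : ∀ x s, τ x s ∈ stdSimplex ℝ B) (x : X) (s : S) :
    ∑ y, marginalKernel π τ x s y = 1 := by
  classical
  simp only [marginalKernel]
  rw [Finset.sum_comm, ← (hτ x s).2]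
  simp

end Kernels

/-! ### The memoryless channel as a resampling symmetry -/

section Resampling

set_option linter.unusedSectionVars false

variable {Ω S X Y B Z : Type*} [Fintype Ω] [Fintype S] [Fintype X] [Fintype Y] [Fintype B]
  [Fintype Z]

/-- Under `p`, the output `out` is drawn from the kernel `τ` at the current input and state,
independently of everything that replacing the output by `up` does not change. -/
structure Resampling (p : Ω → ℝ) (τ : X → S → B → ℝ) (St : Ω → S) (In : Ω → X) (out : Ω → B)
    (up : Ω → B → Ω) : Prop where
  nonneg : ∀ ω, 0 ≤ p ω
  kernel : ∀ x s, τ x s ∈ stdSimplex ℝ B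
  out_up : ∀ ω b, out (up ω b) = b
  up_up : ∀ ω b, up (up ω b) (out ω) = ω
  state_up : ∀ ω b, St (up ω b) = St ω
  input_up : ∀ ω b, In (up ω b) = In ω
  weight : ∀ ω b, p ω * τ (In ω) (St ω) b = p (up ω b) * τ (In ω) (St ω) (out ω)

namespace Resampling

variable {p : Ω → ℝ} {τ : X → S → B → ℝ} {St : Ω → S} {In : Ω → X} {out : Ω → B}
  {up : Ω → B → Ω} (h : Resampling p τ St In out up)
include h

/-- Swapping the true output with an independent draw `b` is an involution of `Ω × B` that preserves
the weight `p ω * τ (In ω) (St ω) b`. So the output may be averaged against the kernel when the rest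
of the integrand does not see it. -/
theorem sum_eq (φ : Ω → ℝ) (hφ : ∀ ω b, φ (up ω b) = φ ω) (g : B → ℝ) :
    ∑ ω, p ω * φ ω * g (out ω) = ∑ ω, p ω * φ ω * ∑ b, τ (In ω) (St ω) b * g b := by
  have h1 : ∑ ω, p ω * φ ω * g (out ω) =
      ∑ z : Ω × B, p z.1 * τ (In z.1) (St z.1) z.2 * φ z.1 * g (out z.1) := by
    rw [Fintype.sum_prod_type]
    refine Finset.sum_congr rfl fun ω _ => ?_
    simp only [mul_assoc, ← Finset.mul_sum]
    rw [← Finset.sum_mul, (h.kernel _ _).2, one_mul]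
  have h2 : ∑ ω, p ω * φ ω * ∑ b, τ (In ω) (St ω) b * g b =
      ∑ z : Ω × B, p z.1 * τ (In z.1) (St z.1) z.2 * φ z.1 * g z.2 := by
    rw [Fintype.sum_prod_type]
    refine Finset.sum_congr rfl fun ω _ => ?_
    rw [Finset.mul_sum]
    refine Finset.sum_congr rfl fun b _ => ?_
    ring
  let e : Ω × B ≃ Ω × B :=
    { toFun := fun z => (up z.1 z.2, out z.1)
      invFun := fun z => (up z.1 z.2, out z.1)
      left_inv := fun z => by simp [h.up_up, h.out_up]
      right_inv := fun z => by simp [h.up_up, h.out_up] }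
  rw [h1, h2, ← e.sum_comp]
  refine Finset.sum_congr rfl fun z _ => ?_
  simp only [e, Equiv.coe_fn_mk, h.out_up, h.input_up, h.state_up, hφ]
  rw [h.weight z.1 z.2]

variable (π : B → Y) {Zv : Ω → Z} (hZ : ∀ ω b, Zv (up ω b) = Zv ω)
include hZ

/-- The Markov chain $Z-(S,X)-Y$ for any `Zv` untouched by the resampling: `sum_eq` is applied to
indicators. -/
theorem law_output (y : Y) (s : S) (z : Z) :
    law p (fun ω => (π (out ω), Zv ω, St ω)) (y, z, s) =
      ∑ x, law p (fun ω => (Zv ω, St ω, In ω)) (z, s, x) * marginalKernel π τ x s y := by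
  classical
  have h1 := h.sum_eq (fun ω => if Zv ω = z ∧ St ω = s then 1 else 0)
    (by simp [hZ, h.state_up]) (fun b => if π b = y then 1 else 0)
  have h2 := sum_mul_comp p (fun ω => (Zv ω, St ω, In ω))
    fun w => (if w.1 = z ∧ w.2.1 = s then 1 else 0) * marginalKernel π τ w.2.2 w.2.1 y
  simp only [Fintype.sum_prod_type] at h2
  rw [Finset.sum_eq_single z (by simp +contextual) (by simp),
    Finset.sum_eq_single s (by simp +contextual) (by simp)] at h2
  simp only [and_self, if_true, one_mul] at h2
  rw [← h2, law_eq_sum]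
  simp only [mul_assoc] at h1
  simp only [marginalKernel]
  refine Eq.trans ?_ (h1.trans ?_)
  · refine Finset.sum_congr rfl fun ω _ => ?_
    simp only [Prod.mk.injEq]
    split_ifs <;> simp_all
  · simp

theorem law_output_state_input (y : Y) (z : Z) (s : S) (x : X) :
    law p (fun ω => (π (out ω), Zv ω, St ω, In ω)) (y, z, s, x) =
      law p (fun ω => (Zv ω, St ω, In ω)) (z, s, x) * marginalKernel π τ x s y := by
  classical
  have h1 := h.sum_eq (fun ω => if Zv ω = z ∧ St ω = s ∧ In ω = x then 1 else 0)
    (by simp [hZ, h.state_up, h.input_up]) (fun b => if π b = y then 1 else 0)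
  rw [law_eq_sum, law_eq_sum, Finset.sum_mul]
  simp only [mul_assoc] at h1
  refine Eq.trans ?_ (h1.trans ?_)
  · refine Finset.sum_congr rfl fun ω _ => ?_
    simp only [Prod.mk.injEq]
    split_ifs <;> simp_all
  · refine Finset.sum_congr rfl fun ω _ => ?_
    simp only [Prod.mk.injEq, marginalKernel]
    split_ifs with h3
    · simp [h3.2.1, h3.2.2]
    · simp

/-- `H(Y | Z, S)`, disintegrated along `Z`. -/
theorem condEntropy_output :
    condEntropy p (fun ω => π (out ω)) (fun ω => (Zv ω, St ω)) =
      ∑ z, outH (marginalKernel π τ)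
        (fun w => law p (fun ω => (Zv ω, St ω, In ω)) (z, w)) := by
  rw [condEntropy_eq_ce h.nonneg, ce, Fintype.sum_prod_type]
  simp only [outH, ce, h.law_output π hZ]

/-- Given state and input, `Zv` carries no further information on the output. In the product rule
for `negMulLog2`, the terms from the law of the conditioning variables cancel because the kernel has
mass one. -/
theorem condEntropy_output_input :
    condEntropy p (fun ω => π (out ω)) (fun ω => (Zv ω, St ω, In ω)) =
      noiseH (marginalKernel π τ) (law p fun ω => (St ω, In ω)) := by
  rw [condEntropy_eq_ce h.nonneg, ce]
  simp only [h.law_output_state_input π hZ, ← Finset.mul_sum,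
    sum_marginalKernel π h.kernel, negMulLog2_mul, Finset.sum_add_distrib, ← Finset.sum_mul]
  have h1 : negMulLog2 1 = 0 := by simp [negMulLog2]
  simp only [h1, one_mul, mul_zero, add_zero, add_sub_cancel_left, noiseH]
  rw [Fintype.sum_prod_type_right]
  refine Finset.sum_congr rfl fun w _ => ?_
  simp only [Prod.eta]
  rw [← Finset.sum_mul, sum_law_pair p Zv (fun ω => (St ω, In ω))]

omit hZ

theorem condEntropy_state :
    condEntropy p St (fun ω => π (out ω)) =
      inH (marginalKernel π τ) (law p fun ω => (St ω, In ω)) := by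
  classical
  rw [condEntropy_eq_ce h.nonneg, inH]
  congr 1; ext s y
  have h1 := h.law_output π (Zv := fun _ => ()) (by simp) y s ()
  have h2 : law p (fun ω => (St ω, π (out ω))) (s, y) =
      law p (fun ω => (π (out ω), (), St ω)) (y, (), s) := by
    simp only [law_eq_sum, Prod.mk.injEq, true_and, and_comm]
  rw [h2, h1]
  simp only [law_eq_sum, Prod.mk.injEq, true_and]

theorem condEntropy_output_state :
    condEntropy p (fun ω => π (out ω)) St =
      outH (marginalKernel π τ) (law p fun ω => (St ω, In ω)) := by
  classical
  rw [condEntropy_eq_ce h.nonneg, outH]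
  congr 1; ext y s
  have h1 := h.law_output π (Zv := fun _ => ()) (by simp) y s ()
  have h2 : law p (fun ω => (π (out ω), St ω)) (y, s) =
      law p (fun ω => (π (out ω), (), St ω)) (y, (), s) := by
    simp only [law_eq_sum, Prod.mk.injEq, true_and]
  rw [h2, h1]
  simp only [law_eq_sum, Prod.mk.injEq, true_and]

end Resampling

end Resampling

/-! ### Realizing a decomposition with two refinements by a test channel -/

section Realization

set_option linter.unusedSectionVars false

variable {S X Y₁ Y₂ U V W : Type*} [Fintype S] [Fintype X] [Fintype Y₁] [Fintype Y₂]
  [Fintype U] [Fintype V] [Fintype W]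

/-- Replacing the channel outputs in the single-letter sample space. -/
def replaceOutput (ω : S × W × U × V × X × Y₁ × Y₂) (b : Y₁ × Y₂) :
    S × W × U × V × X × Y₁ × Y₂ :=
  (ω.1, ω.2.1, ω.2.2.1, ω.2.2.2.1, ω.2.2.2.2.1, b)

theorem resampling_letter (ch : Channel S X Y₁ Y₂) (ρ : S × W × U × V × X → ℝ)
    (hρ : ∀ z, 0 ≤ ρ z) :
    Resampling (fun ω : S × W × U × V × X × Y₁ × Y₂ =>
        ρ (ω.1, ω.2.1, ω.2.2.1, ω.2.2.2.1, ω.2.2.2.2.1) *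
          ch.trans ω.2.2.2.2.1 ω.1 ω.2.2.2.2.2)
      ch.trans rvS rvX (fun ω => ω.2.2.2.2.2) replaceOutput where
  nonneg ω := mul_nonneg (hρ _) ((ch.trans_mem _ _).1 _)
  kernel := ch.trans_mem
  out_up _ _ := rfl
  up_up _ _ := rfl
  state_up _ _ := rfl
  input_up _ _ := rfl
  weight ω b := by simp only [replaceOutput, rvS, rvX]; ring

/-- Random variables that do not involve the channel output have the law given by `ρ`. -/
theorem law_letter {Z : Type*} [Fintype Z] (ch : Channel S X Y₁ Y₂)
    (ρ : S × W × U × V × X → ℝ) (ζ : S × W × U × V × X → Z) (z : Z) :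
    law (fun ω : S × W × U × V × X × Y₁ × Y₂ =>
        ρ (ω.1, ω.2.1, ω.2.2.1, ω.2.2.2.1, ω.2.2.2.2.1) *
          ch.trans ω.2.2.2.2.1 ω.1 ω.2.2.2.2.2)
      (fun ω => ζ (ω.1, ω.2.1, ω.2.2.1, ω.2.2.2.1, ω.2.2.2.2.1)) z = law ρ ζ z := by
  classical
  rw [law_eq_sum, law_eq_sum]
  simp only [Fintype.sum_prod_type (α₁ := S), Fintype.sum_prod_type (α₁ := W),
    Fintype.sum_prod_type (α₁ := U), Fintype.sum_prod_type (α₁ := V),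
    Fintype.sum_prod_type (α₁ := X)]
  refine Finset.sum_congr rfl fun s _ => Finset.sum_congr rfl fun w _ =>
    Finset.sum_congr rfl fun u _ => Finset.sum_congr rfl fun v _ =>
    Finset.sum_congr rfl fun x _ => ?_
  split_ifs
  · rw [← Finset.mul_sum, (ch.trans_mem x s).2, mul_one]
  · simp

variable {ch : Channel S X Y₁ Y₂} {t : W → S × X → ℝ} {r : W → U → S × X → ℝ}
  {r' : W → V → S × X → ℝ}

/-- The joint measure under which `U` and `V` are conditionally independent given `(W, S, X)`. -/
def gluedMeasure (t : W → S × X → ℝ) (r : W → U → S × X → ℝ) (r' : W → V → S × X → ℝ)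
    (z : S × W × U × V × X) : ℝ :=
  r z.2.1 z.2.2.1 (z.1, z.2.2.2.2) * r' z.2.1 z.2.2.2.1 (z.1, z.2.2.2.2) /
    t z.2.1 (z.1, z.2.2.2.2)

variable (hr : ∀ j u i, 0 ≤ r j u i) (hr' : ∀ j v i, 0 ≤ r' j v i)
  (ht : ∀ j, ∑ u, r j u = t j) (ht' : ∀ j, ∑ v, r' j v = t j)

include hr ht in
theorem split_eq_zero {j : W} {i : S × X} (h : t j i = 0) (u : U) : r j u i = 0 := by
  rw [← ht, Finset.sum_apply] at h
  exact (Finset.sum_eq_zero_iff_of_nonneg fun u _ => hr j u i).1 h u (Finset.mem_univ u)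

include hr ht in
theorem split_total_nonneg (j : W) (i : S × X) : 0 ≤ t j i := by
  rw [← ht, Finset.sum_apply]; exact Finset.sum_nonneg fun u _ => hr j u i

include hr hr' ht in
theorem gluedMeasure_nonneg (z : S × W × U × V × X) : 0 ≤ gluedMeasure t r r' z :=
  div_nonneg (mul_nonneg (hr _ _ _) (hr' _ _ _)) (split_total_nonneg hr ht _ _)

include hr ht ht' in
-- Summing `r'` over `v` gives `t`, which cancels the denominator; where `t` vanishes, so does its
-- nonnegative part `r`, and division by zero does no harm.
theorem sum_gluedMeasure_V (s : S) (j : W) (u : U) (x : X) :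
    ∑ v, gluedMeasure t r r' (s, j, u, v, x) = r j u (s, x) := by
  simp only [gluedMeasure]
  rw [← Finset.sum_div, ← Finset.mul_sum, ← Finset.sum_apply, ht']
  by_cases h : t j (s, x) = 0
  · rw [split_eq_zero hr ht h u]; simp
  · rw [mul_div_cancel_right₀ _ h]

include hr' ht ht' in
theorem sum_gluedMeasure_U (s : S) (j : W) (v : V) (x : X) :
    ∑ u, gluedMeasure t r r' (s, j, u, v, x) = r' j v (s, x) := by
  simp only [gluedMeasure]
  rw [← Finset.sum_div, ← Finset.sum_mul, ← Finset.sum_apply, ht]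
  by_cases h : t j (s, x) = 0
  · rw [split_eq_zero hr' ht' h v]; simp
  · rw [mul_div_cancel_left₀ _ h]

include hr ht ht' in
theorem law_gluedMeasure_WU (j : W) (u : U) (w : S × X) :
    law (gluedMeasure t r r') (fun z => ((z.2.1, z.2.2.1), z.1, z.2.2.2.2)) ((j, u), w) =
      r j u w := by
  classical
  obtain ⟨s, x⟩ := w
  rw [← sum_gluedMeasure_V hr ht ht', law_eq_sum]
  simp only [Fintype.sum_prod_type, Prod.mk.injEq]
  rw [Finset.sum_eq_single s (by simp +contextual) (by simp),
    Finset.sum_eq_single j (by simp +contextual) (by simp),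
    Finset.sum_eq_single u (by simp +contextual) (by simp)]
  simp

include hr' ht ht' in
theorem law_gluedMeasure_WV (j : W) (v : V) (w : S × X) :
    law (gluedMeasure t r r') (fun z => ((z.2.1, z.2.2.2.1), z.1, z.2.2.2.2)) ((j, v), w) =
      r' j v w := by
  classical
  obtain ⟨s, x⟩ := w
  rw [← sum_gluedMeasure_U hr' ht ht', law_eq_sum]
  simp only [Fintype.sum_prod_type, Prod.mk.injEq]
  rw [Finset.sum_eq_single s (by simp +contextual) (by simp),
    Finset.sum_eq_single j (by simp +contextual) (by simp)]
  refine Finset.sum_congr rfl fun u _ => ?_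
  rw [Finset.sum_eq_single v (by simp +contextual) (by simp)]
  simp

include hr ht ht' in
theorem law_gluedMeasure_W (j : W) (w : S × X) :
    law (gluedMeasure t r r') (fun z => (z.2.1, z.1, z.2.2.2.2)) (j, w) = t j w := by
  classical
  rw [← ht, Finset.sum_apply]
  simp only [← law_gluedMeasure_WU hr ht ht']
  rw [← sum_law_pair _ (fun z : S × W × U × V × X => z.2.2.1)]
  refine Finset.sum_congr rfl fun u _ => ?_
  simp only [law_eq_sum, Prod.mk.injEq]
  refine Finset.sum_congr rfl fun z _ => ?_
  congr 1
  simp only [eq_iff_iff]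
  tauto

include hr ht ht' in
theorem law_gluedMeasure (w : S × X) :
    law (gluedMeasure t r r') (fun z => (z.1, z.2.2.2.2)) w = ∑ j, t j w := by
  rw [← sum_law_pair _ (fun z : S × W × U × V × X => z.2.1)]
  simp only [law_gluedMeasure_W hr ht ht']

include hr hr' ht ht' in
/-- Every pair of refinements of a decomposition of a state-input measure comes from a test
channel. -/
theorem exists_letterJoint (hq : ∀ s, ∑ x, ∑ j, t j (s, x) = ch.stateP s) :
    ∃ P : S → W × U × V × X → ℝ, (∀ s, P s ∈ stdSimplex ℝ (W × U × V × X)) ∧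
      letterJoint ch P = fun ω : S × W × U × V × X × Y₁ × Y₂ =>
        gluedMeasure t r r' (ω.1, ω.2.1, ω.2.2.1, ω.2.2.2.1, ω.2.2.2.2.1) *
          ch.trans ω.2.2.2.2.1 ω.1 ω.2.2.2.2.2 := by
  classical
  set ρ := gluedMeasure t r r' with hρ
  have h0 : ∀ z, 0 ≤ ρ z := gluedMeasure_nonneg hr hr' ht
  have hs : ∀ s, ∑ z : W × U × V × X, ρ (s, z) = ch.stateP s := by
    intro s
    rw [← hq]
    simp only [← law_gluedMeasure hr ht ht']
    have h1 : law ρ (fun z => z.1) s = ∑ z : W × U × V × X, ρ (s, z) := by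
      rw [law_eq_sum, Fintype.sum_prod_type,
        Finset.sum_eq_single s (by simp +contextual) (by simp)]
      simp
    rw [← h1, ← sum_law_pair _ (fun z : S × W × U × V × X => z.2.2.2.2)]
    refine Finset.sum_congr rfl fun x _ => ?_
    simp only [law_eq_sum, Prod.mk.injEq, and_comm]
    rfl
  -- At states of probability zero the conditional law is arbitrary; the one at a state `s₀` of
  -- positive probability is used. There `ρ` vanishes, so the joint measure is unaffected.
  obtain ⟨s₀, hs₀⟩ : ∃ s, ch.stateP s ≠ 0 := by
    by_contra! h
    have := ch.stateP_mem.2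
    simp [h] at this
  have hmem : ∀ s, ch.stateP s ≠ 0 →
      (fun z => ρ (s, z) / ch.stateP s) ∈ stdSimplex ℝ (W × U × V × X) := fun s h =>
    ⟨fun z => div_nonneg (h0 _) (ch.stateP_mem.1 s), by
      rw [← Finset.sum_div, hs, div_self h]⟩
  refine ⟨fun s => if ch.stateP s = 0 then fun z => ρ (s₀, z) / ch.stateP s₀
    else fun z => ρ (s, z) / ch.stateP s, fun s => ?_, ?_⟩
  · dsimp only
    split_ifs with h
    · exact hmem _ hs₀
    · exact hmem _ h
  · ext ⟨s, w, u, v, x, y₁, y₂⟩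
    simp only [letterJoint]
    split_ifs with h
    · have h1 := hs s
      rw [h, Finset.sum_eq_zero_iff_of_nonneg fun z _ => h0 _] at h1
      rw [h1 _ (Finset.mem_univ _), h]; simp
    · rw [mul_div_cancel₀ _ h]

end Realization

/-! ### Single-letter conditions with slack, and the limit of vanishing slack -/

section SingleLetter

set_option linter.unusedSectionVars false

variable {Ω A B C D : Type*} [Fintype Ω] [Fintype A] [Fintype B] [Fintype C] [Fintype D]

/-- Symmetry of mutual information, which expresses every rate bound through output entropies. -/
theorem condMutualInfo_eq {p : Ω → ℝ} (hp : ∀ ω, 0 ≤ p ω) (X : Ω → A) (Y : Ω → B) (Z : Ω → C) :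
    condMutualInfo p X Y Z = condEntropy p Y Z - condEntropy p Y (fun ω => (X ω, Z ω)) := by
  have h : entropy p (fun ω => (X ω, Y ω, Z ω)) = entropy p (fun ω => (Y ω, X ω, Z ω)) :=
    entropy_congr hp fun ω ω' => by simp only [Prod.mk.injEq]; tauto
  simp only [condMutualInfo, condEntropy_eq hp, h]
  ring

theorem condEntropy_congr_right {p : Ω → ℝ} (hp : ∀ ω, 0 ≤ p ω) (X : Ω → A) {Y : Ω → B}
    {Z : Ω → C} (h : ∀ ω ω', Y ω = Y ω' ↔ Z ω = Z ω') : condEntropy p X Y = condEntropy p X Z := by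
  rw [condEntropy_eq hp, condEntropy_eq hp, entropy_congr hp h, entropy_congr (X := fun ω =>
    (X ω, Y ω)) (Y := fun ω => (X ω, Z ω)) hp fun ω ω' => by simp only [Prod.mk.injEq, h ω ω']]

variable {S X Y₁ Y₂ : Type*} [Fintype S] [Fintype X] [Fintype Y₁] [Fintype Y₂]

/-- The transition function of the first receiver. -/
def Channel.trans₁ (ch : Channel S X Y₁ Y₂) : X → S → Y₁ → ℝ := marginalKernel Prod.fst ch.trans

/-- The transition function of the second receiver. -/
def Channel.trans₂ (ch : Channel S X Y₁ Y₂) : X → S → Y₂ → ℝ := marginalKernel Prod.snd ch.trans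

/-- The output entropies given the state at the two receivers. -/
def Channel.outputH (ch : Channel S X Y₁ Y₂) (q : S × X → ℝ) : ℝ × ℝ :=
  (outH ch.trans₁ q, outH ch.trans₂ q)

theorem Channel.outputH_smul (ch : Channel S X Y₁ Y₂) (c : ℝ) (q : S × X → ℝ) :
    ch.outputH (c • q) = c • ch.outputH q := by
  simp [Channel.outputH, outH_smul]

theorem Channel.continuous_outputH (ch : Channel S X Y₁ Y₂) : Continuous ch.outputH := by
  unfold Channel.outputH
  fun_prop

/-- The single-letter conditions with slack `δ`, in terms of the state-input measure `q`, and the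
output entropies `h`, `a` and `b` given `(W, S)`, `(W, U, S)` and `(W, V, S)`. -/
def SlackFeasible (ch : Channel S X Y₁ Y₂) (R₀ R₁ R₂ E₁ E₂ : ℝ)
    (z : ((S × X → ℝ) × (ℝ × ℝ) × (ℝ × ℝ) × (ℝ × ℝ)) × ℝ) : Prop :=
  let q := z.1.1
  let h := z.1.2.1
  let a := z.1.2.2.1
  let b := z.1.2.2.2
  let I₀ := min (outH ch.trans₁ q - h.1) (outH ch.trans₂ q - h.2)
  (∀ s, ∑ x, q (s, x) = ch.stateP s) ∧
  R₀ ≤ I₀ + z.2 ∧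
  R₀ + R₁ ≤ I₀ + (h.1 - a.1) + z.2 ∧
  R₀ + R₂ ≤ I₀ + (h.2 - b.2) + z.2 ∧
  R₀ + R₁ + R₂ ≤ I₀ + (h.1 - a.1) + (a.2 - noiseH ch.trans₂ q) + z.2 ∧
  R₀ + R₁ + R₂ ≤ I₀ + (b.1 - noiseH ch.trans₁ q) + (h.2 - b.2) + z.2 ∧
  ∑ s, negMulLog2 (ch.stateP s) - inH ch.trans₁ q ≤ E₁ + z.2 ∧
  ∑ s, negMulLog2 (ch.stateP s) - inH ch.trans₂ q ≤ E₂ + z.2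

theorem isClosed_slackFeasible (ch : Channel S X Y₁ Y₂) (R₀ R₁ R₂ E₁ E₂ : ℝ) :
    IsClosed {z | SlackFeasible ch R₀ R₁ R₂ E₁ E₂ z} := by
  unfold SlackFeasible
  simp only [Set.ofPred_and, Set.ofPred_forall]
  refine (isClosed_iInter fun s => isClosed_eq (by fun_prop) (by fun_prop)).inter ?_
  iterate 6 refine (isClosed_le (by fun_prop) (by fun_prop)).inter ?_
  exact isClosed_le (by fun_prop) (by fun_prop)

/-- Points for the slacks $1/(n+1)$ lie in one compact set even if their auxiliary alphabets grow.
The slack is itself a coordinate of the closed set of feasible pairs, so it passes to the limit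
along the subsequence. -/
theorem exists_slackFeasible_zero {ch : Channel S X Y₁ Y₂} {R₀ R₁ R₂ E₁ E₂ : ℝ}
    (h : ∀ δ : ℝ, 0 < δ → ∃ z ∈ splitHull ch.outputH, SlackFeasible ch R₀ R₁ R₂ E₁ E₂ (z, δ)) :
    ∃ z ∈ splitHull ch.outputH, SlackFeasible ch R₀ R₁ R₂ E₁ E₂ (z, 0) := by
  choose z hz hzf using fun n : ℕ => h (1 / ((n : ℝ) + 1)) (by positivity)
  obtain ⟨w, hw, g, hg, hlim⟩ :=
    (isCompact_splitHull ch.continuous_outputH).tendsto_subseq hz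
  refine ⟨w, hw, ?_⟩
  exact (isClosed_slackFeasible ch R₀ R₁ R₂ E₁ E₂).mem_of_tendsto
    (hlim.prodMk_nhds ((tendsto_one_div_add_atTop_nhds_zero_nat (𝕜 := ℝ)).comp hg.tendsto_atTop))
    (Filter.Eventually.of_forall fun n => hzf (g n))

end SingleLetter

/-- Every point of the split hull that satisfies the single-letter conditions comes from a test
channel. -/
theorem exists_testChannel {S X Y₁ Y₂ : Type*} [Fintype S] [Fintype X]
    [Fintype Y₁] [Fintype Y₂] (ch : Channel S X Y₁ Y₂) (R₀ R₁ R₂ E₁ E₂ : ℝ)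
    {z : (S × X → ℝ) × (ℝ × ℝ) × (ℝ × ℝ) × (ℝ × ℝ)}
    (hz : z ∈ splitHull ch.outputH) (hf : SlackFeasible ch R₀ R₁ R₂ E₁ E₂ (z, 0)) :
    ∃ (a b c : ℕ) (P : S → Fin a × Fin b × Fin c × X → ℝ),
      (∀ s, P s ∈ stdSimplex ℝ (Fin a × Fin b × Fin c × X)) ∧
      let p := letterJoint ch P
      let I_W_Y₁ := condMutualInfo p rvW rvY₁
        rvS
      let I_W_Y₂ := condMutualInfo p rvW rvY₂
        rvS
      let I_U_Y₁ := condMutualInfo p rvU rvY₁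
        (fun ω => (rvW ω, rvS ω))
      let I_V_Y₂ := condMutualInfo p rvV rvY₂
        (fun ω => (rvW ω, rvS ω))
      R₀ ≤ min I_W_Y₁ I_W_Y₂ ∧
      R₀ + R₁ ≤ min I_W_Y₁ I_W_Y₂ + I_U_Y₁ ∧
      R₀ + R₂ ≤ min I_W_Y₁ I_W_Y₂ + I_V_Y₂ ∧
      R₀ + R₁ + R₂ ≤ min I_W_Y₁ I_W_Y₂ + I_U_Y₁ +
        condMutualInfo p rvX rvY₂
          (fun ω => (rvW ω, rvU ω, rvS ω)) ∧
      R₀ + R₁ + R₂ ≤ min I_W_Y₁ I_W_Y₂ +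
        condMutualInfo p rvX rvY₁
          (fun ω => (rvW ω, rvV ω, rvS ω)) + I_V_Y₂ ∧
      mutualInfo p rvS rvY₁ ≤ E₁ ∧
      mutualInfo p rvS rvY₂ ≤ E₂ := by
  classical
  obtain ⟨a, b, c, t, r, r', hr, hr', ht, ht', rfl⟩ := exists_of_mem_splitHull ch.outputH_smul hz
  obtain ⟨hq, hf⟩ := hf
  simp only [Finset.sum_apply] at hq
  obtain ⟨P, hP, hp⟩ := exists_letterJoint hr hr' ht ht' hq
  refine ⟨a, b, c, P, hP, ?_⟩
  intro p I_W_Y₁ I_W_Y₂ I_U_Y₁ I_V_Y₂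
  have hρ := gluedMeasure_nonneg hr hr' ht
  have hres := resampling_letter (W := Fin a) (U := Fin b) (V := Fin c) ch _ hρ
  rw [← hp] at hres
  change Resampling p _ _ _ _ _ at hres
  have h0 := hres.nonneg
  -- Three marginals, those of $(W,S,X)$, $(W,U,S,X)$ and $(W,V,S,X)$, determine every information
  -- quantity needed below; the coupling of $U$ and $V$ plays no role.
  have lW : ∀ j, (fun w => law p (fun ω => (rvW ω, rvS ω, rvX ω)) (j, w)) = t j := fun j => by
    ext w
    change law (letterJoint ch P) _ _ = _
    rw [hp, ← law_gluedMeasure_W hr ht ht' j w]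
    exact law_letter ch _ (fun z => (z.2.1, z.1, z.2.2.2.2)) (j, w)
  have lWU : ∀ j u, (fun w => law p (fun ω => ((rvW ω, rvU ω), rvS ω, rvX ω)) ((j, u), w)) =
      r j u := fun j u => by
    ext w
    change law (letterJoint ch P) _ _ = _
    rw [hp, ← law_gluedMeasure_WU hr ht ht' j u w]
    exact law_letter ch _ (fun z => ((z.2.1, z.2.2.1), z.1, z.2.2.2.2)) ((j, u), w)
  have lWV : ∀ j v, (fun w => law p (fun ω => ((rvW ω, rvV ω), rvS ω, rvX ω)) ((j, v), w)) =
      r' j v := fun j v => by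
    ext w
    change law (letterJoint ch P) _ _ = _
    rw [hp, ← law_gluedMeasure_WV hr' ht ht' j v w]
    exact law_letter ch _ (fun z => ((z.2.1, z.2.2.2.1), z.1, z.2.2.2.2)) ((j, v), w)
  have lq : law p (fun ω => (rvS ω, rvX ω)) = ∑ j, t j := by
    ext w
    rw [← sum_law_pair p rvW, Finset.sum_apply]
    exact Finset.sum_congr rfl fun j _ => congrFun (lW j) w
  have lS : entropy p rvS = ∑ s, negMulLog2 (ch.stateP s) := by
    rw [entropy_eq_negMulLog2]
    refine Finset.sum_congr rfl fun s _ => congrArg _ ?_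
    rw [← hq, ← sum_law_pair p rvX]
    refine Finset.sum_congr rfl fun x _ => ?_
    rw [← Finset.sum_apply, ← lq, law_eq_sum, law_eq_sum]
    simp only [Prod.mk.injEq, and_comm]
  have hS1 : condEntropy p rvY₁ rvS = outH ch.trans₁ (∑ j, t j) := by
    rw [← lq]
    exact hres.condEntropy_output_state Prod.fst
  have hE1 : mutualInfo p rvS rvY₁ =
      ∑ s, negMulLog2 (ch.stateP s) - inH ch.trans₁ (∑ j, t j) := by
    rw [mutualInfo, lS, ← lq]
    exact congrArg _ (hres.condEntropy_state Prod.fst)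
  have hW1 : condEntropy p rvY₁ (fun ω => (rvW ω, rvS ω)) = ∑ j, outH ch.trans₁ (t j) := by
    simp only [← lW]
    exact hres.condEntropy_output Prod.fst (Zv := rvW) fun _ _ => rfl
  have hWU1 : condEntropy p rvY₁ (fun ω => ((rvW ω, rvU ω), rvS ω)) =
      ∑ j, ∑ u, outH ch.trans₁ (r j u) := by
    simp only [← lWU, ← Fintype.sum_prod_type']
    exact hres.condEntropy_output Prod.fst (Zv := fun ω => (rvW ω, rvU ω)) fun _ _ => rfl
  have hXU1 : condEntropy p rvY₁ (fun ω => ((rvW ω, rvU ω), rvS ω, rvX ω)) =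
      noiseH ch.trans₁ (∑ j, t j) := by
    rw [← lq]
    exact hres.condEntropy_output_input Prod.fst (Zv := fun ω => (rvW ω, rvU ω)) fun _ _ => rfl
  have hWV1 : condEntropy p rvY₁ (fun ω => ((rvW ω, rvV ω), rvS ω)) =
      ∑ j, ∑ v, outH ch.trans₁ (r' j v) := by
    simp only [← lWV, ← Fintype.sum_prod_type']
    exact hres.condEntropy_output Prod.fst (Zv := fun ω => (rvW ω, rvV ω)) fun _ _ => rfl
  have hXV1 : condEntropy p rvY₁ (fun ω => ((rvW ω, rvV ω), rvS ω, rvX ω)) =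
      noiseH ch.trans₁ (∑ j, t j) := by
    rw [← lq]
    exact hres.condEntropy_output_input Prod.fst (Zv := fun ω => (rvW ω, rvV ω)) fun _ _ => rfl
  have eW1 : I_W_Y₁ = outH ch.trans₁ (∑ j, t j) - ∑ j, outH ch.trans₁ (t j) := by
    rw [← hS1, ← hW1]
    exact condMutualInfo_eq h0 _ _ _
  have hS2 : condEntropy p rvY₂ rvS = outH ch.trans₂ (∑ j, t j) := by
    rw [← lq]
    exact hres.condEntropy_output_state Prod.snd
  have hE2 : mutualInfo p rvS rvY₂ =
      ∑ s, negMulLog2 (ch.stateP s) - inH ch.trans₂ (∑ j, t j) := by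
    rw [mutualInfo, lS, ← lq]
    exact congrArg _ (hres.condEntropy_state Prod.snd)
  have hW2 : condEntropy p rvY₂ (fun ω => (rvW ω, rvS ω)) = ∑ j, outH ch.trans₂ (t j) := by
    simp only [← lW]
    exact hres.condEntropy_output Prod.snd (Zv := rvW) fun _ _ => rfl
  have hWU2 : condEntropy p rvY₂ (fun ω => ((rvW ω, rvU ω), rvS ω)) =
      ∑ j, ∑ u, outH ch.trans₂ (r j u) := by
    simp only [← lWU, ← Fintype.sum_prod_type']
    exact hres.condEntropy_output Prod.snd (Zv := fun ω => (rvW ω, rvU ω)) fun _ _ => rfl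
  have hXU2 : condEntropy p rvY₂ (fun ω => ((rvW ω, rvU ω), rvS ω, rvX ω)) =
      noiseH ch.trans₂ (∑ j, t j) := by
    rw [← lq]
    exact hres.condEntropy_output_input Prod.snd (Zv := fun ω => (rvW ω, rvU ω)) fun _ _ => rfl
  have hWV2 : condEntropy p rvY₂ (fun ω => ((rvW ω, rvV ω), rvS ω)) =
      ∑ j, ∑ v, outH ch.trans₂ (r' j v) := by
    simp only [← lWV, ← Fintype.sum_prod_type']
    exact hres.condEntropy_output Prod.snd (Zv := fun ω => (rvW ω, rvV ω)) fun _ _ => rfl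
  have hXV2 : condEntropy p rvY₂ (fun ω => ((rvW ω, rvV ω), rvS ω, rvX ω)) =
      noiseH ch.trans₂ (∑ j, t j) := by
    rw [← lq]
    exact hres.condEntropy_output_input Prod.snd (Zv := fun ω => (rvW ω, rvV ω)) fun _ _ => rfl
  have eW2 : I_W_Y₂ = outH ch.trans₂ (∑ j, t j) - ∑ j, outH ch.trans₂ (t j) := by
    rw [← hS2, ← hW2]
    exact condMutualInfo_eq h0 _ _ _
  have eU : I_U_Y₁ = ∑ j, outH ch.trans₁ (t j) - ∑ j, ∑ u, outH ch.trans₁ (r j u) := by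
    rw [← hW1, ← hWU1]
    refine (condMutualInfo_eq h0 _ _ _).trans (congrArg _ (condEntropy_congr_right h0 _ ?_))
    simp only [Prod.mk.injEq]; tauto
  have eXU : condMutualInfo p rvX rvY₂ (fun ω => (rvW ω, rvU ω, rvS ω)) =
      ∑ j, ∑ u, outH ch.trans₂ (r j u) - noiseH ch.trans₂ (∑ j, t j) := by
    rw [← hWU2, ← hXU2]
    refine (condMutualInfo_eq h0 _ _ _).trans (congrArg₂ _ (condEntropy_congr_right h0 _ ?_)
      (condEntropy_congr_right h0 _ ?_))
    all_goals simp only [Prod.mk.injEq]; tauto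
  have eV : I_V_Y₂ = ∑ j, outH ch.trans₂ (t j) - ∑ j, ∑ v, outH ch.trans₂ (r' j v) := by
    rw [← hW2, ← hWV2]
    refine (condMutualInfo_eq h0 _ _ _).trans (congrArg _ (condEntropy_congr_right h0 _ ?_))
    simp only [Prod.mk.injEq]; tauto
  have eXV : condMutualInfo p rvX rvY₁ (fun ω => (rvW ω, rvV ω, rvS ω)) =
      ∑ j, ∑ v, outH ch.trans₁ (r' j v) - noiseH ch.trans₁ (∑ j, t j) := by
    rw [← hWV1, ← hXV1]
    refine (condMutualInfo_eq h0 _ _ _).trans (congrArg₂ _ (condEntropy_congr_right h0 _ ?_)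
      (condEntropy_congr_right h0 _ ?_))
    all_goals simp only [Prod.mk.injEq]; tauto
  simp only [Channel.outputH, Prod.fst_sum, Prod.snd_sum, add_zero] at hf
  rw [eW1, eW2, eU, eV, eXU, eXV, hE1, hE2]
  exact hf

/-! ### Chain rules and Csiszár's sum identity -/

section Sequences

set_option linter.unusedSectionVars false

variable {Ω A B C D : Type*} [Fintype Ω] [Fintype A] [Fintype B] [Fintype C] [Fintype D] {n : ℕ}

/-- The entries of `x` before position `k`. -/
def before (x : Fin n → A) (k : ℕ) (j : Fin n) : Option A := if j.1 < k then some (x j) else none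

/-- The entries of `x` from position `k` on. -/
def fromPos (x : Fin n → A) (k : ℕ) (j : Fin n) : Option A := if k ≤ j.1 then some (x j) else none

/-- Masking by `none` gives prefixes of all lengths the same type. Only the fibres of a random
variable matter for its entropy, so this description of equality is all that is needed. -/
theorem before_eq_iff {x x' : Fin n → A} {k : ℕ} :
    before x k = before x' k ↔ ∀ j : Fin n, j.1 < k → x j = x' j := by
  rw [funext_iff]
  refine forall_congr' fun j => ?_
  by_cases h : j.1 < k <;> simp [before, h]

theorem fromPos_eq_iff {x x' : Fin n → A} {k : ℕ} :
    fromPos x k = fromPos x' k ↔ ∀ j : Fin n, k ≤ j.1 → x j = x' j := by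
  rw [funext_iff]
  refine forall_congr' fun j => ?_
  by_cases h : k ≤ j.1 <;> simp [fromPos, h]

theorem before_length_eq_iff {x x' : Fin n → A} : before x n = before x' n ↔ x = x' := by
  rw [before_eq_iff, funext_iff]
  exact forall_congr' fun j => by simp

theorem before_zero_eq {x x' : Fin n → A} : before x 0 = before x' 0 := by
  simp [before_eq_iff]

theorem fromPos_zero_eq_iff {x x' : Fin n → A} : fromPos x 0 = fromPos x' 0 ↔ x = x' := by
  rw [fromPos_eq_iff, funext_iff]
  exact forall_congr' fun j => by simp

theorem fromPos_length_eq {x x' : Fin n → A} : fromPos x n = fromPos x' n := by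
  rw [fromPos_eq_iff]
  intro j h
  exact absurd j.2 (by omega)

theorem before_succ_eq_iff {x x' : Fin n → A} (i : Fin n) :
    before x (i + 1) = before x' (i + 1) ↔ x i = x' i ∧ before x i = before x' i := by
  simp only [before_eq_iff]
  constructor
  · exact fun h => ⟨h i (Nat.lt_succ_self _), fun j hj => h j (hj.trans (Nat.lt_succ_self _))⟩
  · rintro ⟨h1, h2⟩ j hj
    rcases (Nat.lt_succ_iff.1 hj).eq_or_lt with h | h
    · rw [Fin.ext h, h1]
    · exact h2 j h

theorem fromPos_eq_succ_iff {x x' : Fin n → A} (i : Fin n) :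
    fromPos x i = fromPos x' i ↔ x i = x' i ∧ fromPos x (i + 1) = fromPos x' (i + 1) := by
  simp only [fromPos_eq_iff]
  constructor
  · exact fun h => ⟨h i le_rfl, fun j hj => h j ((Nat.le_succ _).trans hj)⟩
  · rintro ⟨h1, h2⟩ j hj
    rcases hj.eq_or_lt with h | h
    · rw [← Fin.ext h, h1]
    · exact h2 j h

theorem sum_fin_sub (G : ℕ → ℝ) : ∑ i : Fin n, (G (i + 1) - G i) = G n - G 0 := by
  rw [Fin.sum_univ_eq_sum_range fun i => G (i + 1) - G i, Finset.sum_range_sub]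

variable {p : Ω → ℝ} (hp : ∀ ω, 0 ≤ p ω)
include hp

/-- The entropy of a sequence given `B` is at most the sum of the entropies of its entries given
functions of `B`. -/
theorem entropy_sequence_le (x : Ω → Fin n → A) (b : Ω → B) (b' : Fin n → Ω → C)
    (hb : ∀ i ω ω', b ω = b ω' → b' i ω = b' i ω') :
    entropy p (fun ω => (b ω, x ω)) - entropy p b ≤
      ∑ i, condEntropy p (fun ω => x ω i) (b' i) := by
  have h := sum_fin_sub (n := n) fun k => entropy p fun ω => (b ω, before (x ω) k)
  have h1 : entropy p (fun ω => (b ω, before (x ω) n)) = entropy p (fun ω => (b ω, x ω)) :=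
    entropy_congr hp fun ω ω' => by simp [before_length_eq_iff]
  have h2 : entropy p (fun ω => (b ω, before (x ω) 0)) = entropy p b :=
    entropy_congr hp fun ω ω' => by
      simp only [Prod.mk.injEq, and_iff_left_iff_imp]
      exact fun _ => before_zero_eq
  rw [h1, h2] at h
  rw [← h]
  refine Finset.sum_le_sum fun i _ => ?_
  rw [condEntropy_eq hp]
  -- The increment of the chain rule is $H(x_i\mid b,x_{<i})$, at most $H(x_i\mid b'_i)$ since `b`
  -- determines `b' i`.
  have := entropy_submodular hp (X := fun ω => (x ω i, b' i ω))
    (Y := fun ω => (b ω, before (x ω) i)) (R := fun ω => (b ω, before (x ω) (i + 1))) (T := b' i)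
    (by simp +contextual [before_succ_eq_iff]) (by simp +contextual)
    (by simp only [Prod.mk.injEq]; exact fun ω ω' h => hb i ω ω' h.1)
  linarith

variable (c : Ω → C) (x : Ω → Fin n → A) (y : Ω → Fin n → B)

/-- The conditional entropies of the two sequences given the past of the first and the future of
the second differ from the full conditional entropies by the same amount (Csiszár's sum
identity). -/
theorem csiszar_sum_identity :
    ∑ i : Fin n, condEntropy p (fun ω => x ω i)
        (fun ω => (c ω, before (x ω) i, fromPos (y ω) (i + 1))) -
      (entropy p (fun ω => (c ω, x ω)) - entropy p c) =
    ∑ i : Fin n, condEntropy p (fun ω => y ω i)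
        (fun ω => (c ω, before (x ω) i, fromPos (y ω) (i + 1))) -
      (entropy p (fun ω => (c ω, y ω)) - entropy p c) := by
  -- With $F(k,l)=H(c,x_{<k},y_{\ge l})$, the summands are $F(i+1,i+1)-F(i,i+1)$ and
  -- $F(i,i)-F(i,i+1)$. Their difference telescopes along the diagonal to $F(n,n)-F(0,0)$.
  set F : ℕ → ℕ → ℝ := fun k l => entropy p fun ω => (c ω, before (x ω) k, fromPos (y ω) l)
    with hF
  have h1 : ∀ i : Fin n, condEntropy p (fun ω => x ω i)
      (fun ω => (c ω, before (x ω) i, fromPos (y ω) (i + 1))) =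
      F (i + 1) (i + 1) - F i (i + 1) := fun i => by
    rw [condEntropy_eq hp]
    congr 1
    exact entropy_congr hp fun ω ω' => by
      simp only [Prod.mk.injEq, before_succ_eq_iff]; tauto
  have h2 : ∀ i : Fin n, condEntropy p (fun ω => y ω i)
      (fun ω => (c ω, before (x ω) i, fromPos (y ω) (i + 1))) =
      F i i - F i (i + 1) := fun i => by
    rw [condEntropy_eq hp]
    congr 1
    exact entropy_congr hp fun ω ω' => by
      simp only [Prod.mk.injEq, fromPos_eq_succ_iff]; tauto
  have h3 : F n n = entropy p (fun ω => (c ω, x ω)) := entropy_congr hp fun ω ω' => by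
    simp only [Prod.mk.injEq, before_length_eq_iff,
      iff_true_intro (fromPos_length_eq (x := y ω) (x' := y ω')), and_true]
  have h4 : F 0 0 = entropy p (fun ω => (c ω, y ω)) := entropy_congr hp fun ω ω' => by
    simp only [Prod.mk.injEq, fromPos_zero_eq_iff,
      iff_true_intro (before_zero_eq (x := x ω) (x' := x ω')), true_and]
  have h5 := sum_fin_sub (n := n) fun k => F k k
  rw [← h3, ← h4]
  simp only [h1, h2, Finset.sum_sub_distrib] at h5 ⊢
  linarith

/-- Omitting the future of `y` from the conditioning raises each term to one of the chain rule for
`x`. This fixes the sign of the common defect in `csiszar_sum_identity`. -/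
theorem sum_condEntropy_le :
    ∑ i : Fin n, condEntropy p (fun ω => x ω i)
        (fun ω => (c ω, before (x ω) i, fromPos (y ω) (i + 1))) ≤
      entropy p (fun ω => (c ω, x ω)) - entropy p c := by
  have h := sum_fin_sub (n := n) fun k => entropy p fun ω => (c ω, before (x ω) k)
  have h1 : entropy p (fun ω => (c ω, before (x ω) n)) = entropy p (fun ω => (c ω, x ω)) :=
    entropy_congr hp fun ω ω' => by simp [before_length_eq_iff]
  have h2 : entropy p (fun ω => (c ω, before (x ω) 0)) = entropy p c :=
    entropy_congr hp fun ω ω' => by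
      simp only [Prod.mk.injEq, and_iff_left_iff_imp]
      exact fun _ => before_zero_eq
  rw [h1, h2] at h
  rw [← h]
  refine Finset.sum_le_sum fun i _ => ?_
  rw [condEntropy_eq hp]
  have := entropy_submodular hp (X := fun ω => (c ω, before (x ω) (i + 1)))
    (Y := fun ω => (c ω, before (x ω) i, fromPos (y ω) (i + 1)))
    (R := fun ω => (x ω i, c ω, before (x ω) i, fromPos (y ω) (i + 1)))
    (T := fun ω => (c ω, before (x ω) i))
    (by simp +contextual [before_succ_eq_iff]) (by simp +contextual [before_succ_eq_iff])
    (by simp +contextual)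
  linarith

end Sequences

/-! ### The joint law of a block transmission -/

section Block

set_option linter.unusedSectionVars false

variable {n : ℕ} {M₀ M₁ M₂ S X Y₁ Y₂ : Type*} [Fintype M₀] [Fintype M₁] [Fintype M₂]
  [Fintype S] [Fintype X] [Fintype Y₁] [Fintype Y₂]

/-- Replacing the channel outputs at time `i`. -/
def Outcome.replaceOutput (i : Fin n) (ω : Outcome n M₀ M₁ M₂ S Y₁ Y₂) (b : Y₁ × Y₂) :
    Outcome n M₀ M₁ M₂ S Y₁ Y₂ :=
  ⟨ω.m₀, ω.m₁, ω.m₂, ω.s, Function.update ω.y₁ i b.1, Function.update ω.y₂ i b.2⟩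

variable (c : Code n M₀ M₁ M₂ S X Y₁ Y₂) (ch : Channel S X Y₁ Y₂)

theorem Code.joint_nonneg (ω : Outcome n M₀ M₁ M₂ S Y₁ Y₂) : 0 ≤ c.joint ch ω := by
  unfold Code.joint
  have h1 : 0 ≤ ∏ i, ch.stateP (ω.s i) := Finset.prod_nonneg fun i _ => ch.stateP_mem.1 _
  have h2 : 0 ≤ ∏ i, ch.trans (c.input ω i) (ω.s i) (ω.y₁ i, ω.y₂ i) :=
    Finset.prod_nonneg fun i _ => (ch.trans_mem _ _).1 _
  positivity

/-- There is no feedback: the inputs depend on messages and states only, so changing the outputs at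
time `i` affects a single factor of the product. -/
theorem Code.resampling_joint (i : Fin n) :
    Resampling (c.joint ch) ch.trans (fun ω => ω.s i) (fun ω => c.input ω i)
      (fun ω => (ω.y₁ i, ω.y₂ i)) (Outcome.replaceOutput i) where
  nonneg := c.joint_nonneg ch
  kernel := ch.trans_mem
  out_up ω b := by simp [Outcome.replaceOutput]
  up_up ω b := by simp [Outcome.replaceOutput]
  state_up _ _ := rfl
  input_up _ _ := rfl
  weight ω b := by
    simp only [Code.joint]
    rw [← Finset.mul_prod_erase Finset.univ (fun j => ch.trans _ _ (ω.y₁ j, ω.y₂ j))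
        (Finset.mem_univ i),
      ← Finset.mul_prod_erase Finset.univ (fun j => ch.trans _ _
        ((Outcome.replaceOutput i ω b).y₁ j, (Outcome.replaceOutput i ω b).y₂ j))
        (Finset.mem_univ i)]
    have h : ∏ j ∈ Finset.univ.erase i, ch.trans (c.input (Outcome.replaceOutput i ω b) j)
        ((Outcome.replaceOutput i ω b).s j) ((Outcome.replaceOutput i ω b).y₁ j,
          (Outcome.replaceOutput i ω b).y₂ j) =
        ∏ j ∈ Finset.univ.erase i, ch.trans (c.input ω j) (ω.s j) (ω.y₁ j, ω.y₂ j) := by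
      refine Finset.prod_congr rfl fun j hj => ?_
      have hj' : j ≠ i := Finset.ne_of_mem_erase hj
      simp [Outcome.replaceOutput, Code.input, hj']
    rw [h]
    simp only [Outcome.replaceOutput, Code.input, Function.update_self]
    ring

/-- The channel outputs integrate to one. -/
theorem Code.sum_joint_mul (g : M₀ → M₁ → M₂ → (Fin n → S) → ℝ) :
    ∑ ω, c.joint ch ω * g ω.m₀ ω.m₁ ω.m₂ ω.s =
      ∑ m₀, ∑ m₁, ∑ m₂, ∑ s, ((Fintype.card M₀ : ℝ) * Fintype.card M₁ * Fintype.card M₂)⁻¹ *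
        (∏ i, ch.stateP (s i)) * g m₀ m₁ m₂ s := by
  classical
  rw [← (Outcome.equiv n M₀ M₁ M₂ S Y₁ Y₂).symm.sum_comp]
  simp only [Fintype.sum_prod_type (α₁ := M₀), Fintype.sum_prod_type (α₁ := M₁),
    Fintype.sum_prod_type (α₁ := M₂), Fintype.sum_prod_type (α₁ := Fin n → S)]
  refine Finset.sum_congr rfl fun m₀ _ => Finset.sum_congr rfl fun m₁ _ =>
    Finset.sum_congr rfl fun m₂ _ => Finset.sum_congr rfl fun s _ => ?_
  simp only [Outcome.equiv, Equiv.coe_fn_symm_mk, Code.joint, Code.input]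
  rw [← Finset.sum_mul, ← Finset.mul_sum]
  congr 1
  rw [← (Equiv.arrowProdEquivProdArrow (Fin n) (fun _ => Y₁) (fun _ => Y₂)).sum_comp]
  simp only [Equiv.arrowProdEquivProdArrow, Equiv.coe_fn_mk]
  have h := Finset.prod_univ_sum (fun _ : Fin n => (Finset.univ : Finset (Y₁ × Y₂)))
    fun i b => ch.trans (c.enc m₀ m₁ m₂ s i) (s i) b
  rw [Fintype.piFinset_univ] at h
  rw [← h]
  simp [(ch.trans_mem _ _).2]

theorem sum_prod_stateP : ∑ s : Fin n → S, ∏ i, ch.stateP (s i) = 1 := by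
  classical
  have h := Finset.prod_univ_sum (fun _ : Fin n => (Finset.univ : Finset S))
    fun _ s => ch.stateP s
  rw [Fintype.piFinset_univ] at h
  rw [← h]
  simp [ch.stateP_mem.2]

variable [Nonempty M₀] [Nonempty M₁] [Nonempty M₂]

theorem Code.sum_joint : ∑ ω, c.joint ch ω = 1 := by
  have h := c.sum_joint_mul ch fun _ _ _ _ => 1
  simp only [mul_one] at h
  rw [h]
  simp only [← Finset.mul_sum, sum_prod_stateP, Finset.sum_const, Finset.card_univ, nsmul_eq_mul]
  field_simp

theorem Code.law_state (s : Fin n → S) :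
    law (c.joint ch) (fun ω => ω.s) s = ∏ i, ch.stateP (s i) := by
  classical
  have h := c.sum_joint_mul ch fun _ _ _ s' => if s' = s then 1 else 0
  rw [law_eq_sum]
  simp only [mul_ite, mul_one, mul_zero] at h
  refine Eq.trans (by congr!) (h.trans ?_)
  simp only [Finset.sum_ite_eq', Finset.mem_univ, if_true, Finset.sum_const, Finset.card_univ,
    nsmul_eq_mul]
  field_simp

theorem Code.law_messages_state (m₀ : M₀) (m₁ : M₁) (m₂ : M₂) (s : Fin n → S) :
    law (c.joint ch) (fun ω => (ω.m₀, ω.m₁, ω.m₂, ω.s)) (m₀, m₁, m₂, s) =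
      ((Fintype.card M₀ : ℝ) * Fintype.card M₁ * Fintype.card M₂)⁻¹ * ∏ i, ch.stateP (s i) := by
  classical
  have h := c.sum_joint_mul ch fun m₀' m₁' m₂' s' =>
    if m₀' = m₀ then if m₁' = m₁ then if m₂' = m₂ then if s' = s then 1 else 0 else 0 else 0 else 0
  rw [law_eq_sum]
  simp only [Prod.mk.injEq, ite_and]
  simp only [mul_ite, mul_one, mul_zero] at h
  refine Eq.trans (by congr!) (h.trans ?_)
  rw [Finset.sum_eq_single m₀ (by simp +contextual) (by simp),
    Finset.sum_eq_single m₁ (by simp +contextual) (by simp),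
    Finset.sum_eq_single m₂ (by simp +contextual) (by simp),
    Finset.sum_eq_single s (by simp +contextual) (by simp)]
  simp

theorem Code.law_state_apply (i : Fin n) (a : S) :
    law (c.joint ch) (fun ω => ω.s i) a = ch.stateP a := by
  classical
  rw [law_comp _ (fun ω : Outcome n M₀ M₁ M₂ S Y₁ Y₂ => ω.s) (fun s => s i)]
  simp only [c.law_state ch]
  -- The indicator of `s i = a` is inserted as a factor at coordinate `i`, so that the sum over
  -- sequences factorizes and all other coordinates contribute one.
  have h := Finset.prod_univ_sum (fun _ : Fin n => (Finset.univ : Finset S))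
    fun j s => ch.stateP s * if j = i then if s = a then 1 else 0 else 1
  rw [Fintype.piFinset_univ] at h
  simp only [Finset.prod_mul_distrib, Finset.prod_ite_eq', Finset.mem_univ, if_true] at h
  simp only [mul_ite, mul_one, mul_zero] at h
  rw [← h, Finset.prod_eq_single i]
  · simp
  · intro j _ hj
    simp [hj, ch.stateP_mem.2]
  · simp

theorem Code.prod_stateP_pos {ω : Outcome n M₀ M₁ M₂ S Y₁ Y₂} (h : 0 < c.joint ch ω) :
    0 < ∏ i, ch.stateP (ω.s i) := by
  rw [← c.law_state ch]
  exact h.trans_le (le_law (c.joint_nonneg ch) (fun ω => ω.s) ω)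

/-- The state sequence is i.i.d. -/
theorem Code.entropy_state :
    entropy (c.joint ch) (fun ω => ω.s) = n * ∑ s, negMulLog2 (ch.stateP s) := by
  have h : ∀ i : Fin n, ∑ ω, c.joint ch ω * Real.logb 2 (ch.stateP (ω.s i)) =
      -∑ s, negMulLog2 (ch.stateP s) := fun i => by
    rw [sum_mul_comp _ (fun ω : Outcome n M₀ M₁ M₂ S Y₁ Y₂ => ω.s i)
      fun s => Real.logb 2 (ch.stateP s)]
    simp only [c.law_state_apply ch, negMulLog2_eq, Finset.sum_neg_distrib, neg_neg]
  have h2 : ∑ i : Fin n, ∑ ω, c.joint ch ω * Real.logb 2 (ch.stateP (ω.s i)) =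
      -(n * ∑ s, negMulLog2 (ch.stateP s)) := by simp [h]
  rw [entropy_eq_sum, neg_eq_iff_eq_neg, ← h2, Finset.sum_comm]
  refine Finset.sum_congr rfl fun ω _ => ?_
  rcases (c.joint_nonneg ch ω).eq_or_lt with h0 | h0
  · simp [← h0]
  · rw [c.law_state ch, Real.logb_prod, Finset.mul_sum]
    intro i _ hi
    exact (c.prod_stateP_pos ch h0).ne' (Finset.prod_eq_zero (Finset.mem_univ i) hi)

/-- The messages are uniform and independent of the state sequence. -/
theorem Code.entropy_messages_state :
    entropy (c.joint ch) (fun ω => (ω.m₀, ω.m₁, ω.m₂, ω.s)) =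
      Real.logb 2 (Fintype.card M₀) + Real.logb 2 (Fintype.card M₁) +
        Real.logb 2 (Fintype.card M₂) + entropy (c.joint ch) (fun ω => ω.s) := by
  have e : Real.logb 2 (Fintype.card M₀) + Real.logb 2 (Fintype.card M₁) +
      Real.logb 2 (Fintype.card M₂) = ∑ ω, c.joint ch ω * (Real.logb 2 (Fintype.card M₀) +
        Real.logb 2 (Fintype.card M₁) + Real.logb 2 (Fintype.card M₂)) := by
    rw [← Finset.sum_mul, c.sum_joint ch, one_mul]
  rw [e, entropy_eq_sum, entropy_eq_sum, neg_eq_iff_eq_neg, neg_add, neg_neg,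
    ← Finset.sum_neg_distrib, ← Finset.sum_add_distrib]
  refine Finset.sum_congr rfl fun ω _ => ?_
  rcases (c.joint_nonneg ch ω).eq_or_lt with h0 | h0
  · simp [← h0]
  · rw [c.law_state ch, c.law_messages_state ch, Real.logb_mul (by positivity)
      (c.prod_stateP_pos ch h0).ne', Real.logb_inv, Real.logb_mul (by positivity) (by positivity),
      Real.logb_mul (by positivity) (by positivity)]
    ring

end Block

/-! ### Single-letter auxiliary variables of a block code -/

section Converse

set_option linter.unusedSectionVars false

theorem sum_law_pair_left {Ω A B C : Type*} [Fintype Ω] [Fintype A] [Fintype B] [Fintype C]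
    (p : Ω → ℝ) (Z : Ω → A) (U : Ω → B) (Y : Ω → C) (z : A) (y : C) :
    ∑ u, law p (fun ω => ((Z ω, U ω), Y ω)) ((z, u), y) = law p (fun ω => (Z ω, Y ω)) (z, y) := by
  classical
  rw [← sum_law_pair p U]
  refine Finset.sum_congr rfl fun u _ => ?_
  simp only [law_eq_sum, Prod.mk.injEq]
  refine Finset.sum_congr rfl fun z _ => ?_
  congr 1
  simp only [eq_iff_iff]
  tauto

theorem law_swap {Ω A B : Type*} [Fintype Ω] [Fintype A] [Fintype B] (p : Ω → ℝ) (X : Ω → A)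
    (Y : Ω → B) (a : A) (b : B) :
    law p (fun ω => (X ω, Y ω)) (a, b) = law p (fun ω => (Y ω, X ω)) (b, a) := by
  classical
  simp only [law_eq_sum, Prod.mk.injEq, and_comm]

theorem prob_mono {Ω : Type*} [Fintype Ω] {p : Ω → ℝ} (hp : ∀ ω, 0 ≤ p ω) {E F : Set Ω}
    (h : E ⊆ F) : prob p E ≤ prob p F := by
  classical
  refine Finset.sum_le_sum fun ω _ => ?_
  by_cases h1 : ω ∈ E
  · simp [h1, h h1]
  · simp only [h1, if_false]; split_ifs <;> simp [hp]

theorem noiseH_sum {S X Y J : Type*} [Fintype S] [Fintype X] [Fintype Y] [Fintype J]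
    (T : X → S → Y → ℝ) (q : J → S × X → ℝ) : noiseH T (∑ j, q j) = ∑ j, noiseH T (q j) := by
  simp only [noiseH, Finset.sum_apply, Finset.sum_mul]
  exact Finset.sum_comm

theorem noiseH_smul {S X Y : Type*} [Fintype S] [Fintype X] [Fintype Y]
    (T : X → S → Y → ℝ) (a : ℝ) (q : S × X → ℝ) : noiseH T (a • q) = a * noiseH T q := by
  simp only [noiseH, Finset.mul_sum, Pi.smul_apply, smul_eq_mul, mul_assoc]

variable {n : ℕ} {M₀ M₁ M₂ S X Y₁ Y₂ : Type*} [Fintype M₀] [Fintype M₁] [Fintype M₂]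
  [Fintype S] [Fintype X] [Fintype Y₁] [Fintype Y₂]

theorem Outcome.before_replaceOutput (i : Fin n) (ω : Outcome n M₀ M₁ M₂ S Y₁ Y₂) (b : Y₁ × Y₂) :
    before (ω.replaceOutput i b).y₁ i = before ω.y₁ i := by
  rw [before_eq_iff]
  intro j hj
  exact Function.update_of_ne (fun h => by simp [h] at hj) _ _

theorem Outcome.fromPos_replaceOutput (i : Fin n) (ω : Outcome n M₀ M₁ M₂ S Y₁ Y₂)
    (b : Y₁ × Y₂) : fromPos (ω.replaceOutput i b).y₂ (i + 1) = fromPos ω.y₂ (i + 1) := by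
  rw [fromPos_eq_iff]
  intro j hj
  exact Function.update_of_ne (fun h => by simp [h] at hj) _ _

/-- The identification of the auxiliary variable at time `i`: a variable `Cv` together with the past
of the first output and the future of the second output. -/
def auxVar {C : Type*} (Cv : Outcome n M₀ M₁ M₂ S Y₁ Y₂ → C) (i : Fin n)
    (ω : Outcome n M₀ M₁ M₂ S Y₁ Y₂) : C × (Fin n → Option Y₁) × (Fin n → Option Y₂) :=
  (Cv ω, before ω.y₁ i, fromPos ω.y₂ (i + 1))

/-- The past stops before `i` and the future starts at `i + 1`, so neither contains an output at
time `i`. This makes `auxVar` admissible as `Zv` in the resampling lemmas. -/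
theorem auxVar_replaceOutput {C : Type*} {Cv : Outcome n M₀ M₁ M₂ S Y₁ Y₂ → C} {i : Fin n}
    (hC : ∀ ω b, Cv (ω.replaceOutput i b) = Cv ω) (ω : Outcome n M₀ M₁ M₂ S Y₁ Y₂)
    (b : Y₁ × Y₂) : auxVar Cv i (ω.replaceOutput i b) = auxVar Cv i ω := by
  simp only [auxVar, hC, Outcome.before_replaceOutput, Outcome.fromPos_replaceOutput]

variable (c : Code n M₀ M₁ M₂ S X Y₁ Y₂) (ch : Channel S X Y₁ Y₂)

theorem Code.sum_outH_disintegrated {Y Z : Type*} [Fintype Y] [Fintype Z] (π : Y₁ × Y₂ → Y)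
    (Zv : Fin n → Outcome n M₀ M₁ M₂ S Y₁ Y₂ → Z)
    (hZ : ∀ i ω b, Zv i (ω.replaceOutput i b) = Zv i ω) :
    ∑ i, ∑ z, outH (marginalKernel π ch.trans) ((n : ℝ)⁻¹ • fun w =>
        law (c.joint ch) (fun ω => (Zv i ω, ω.s i, c.input ω i)) (z, w)) =
      (n : ℝ)⁻¹ * ∑ i, condEntropy (c.joint ch) (fun ω => π (ω.y₁ i, ω.y₂ i))
        (fun ω => (Zv i ω, ω.s i)) := by
  simp only [outH_smul, ← Finset.mul_sum]
  congr 1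
  exact Finset.sum_congr rfl fun i _ =>
    ((c.resampling_joint ch i).condEntropy_output π (hZ i)).symm

variable [Nonempty M₀] [Nonempty M₁] [Nonempty M₂]

/-- The single-letter point of a block code. -/
theorem Code.exists_splitHull_point (hn : 0 < n) :
    ∃ z ∈ splitHull ch.outputH, (∀ s, ∑ x, z.1 (s, x) = ch.stateP s) ∧
      z.1 = (n : ℝ)⁻¹ • ∑ i, law (c.joint ch) (fun ω => (ω.s i, c.input ω i)) ∧
      n * z.2.1.1 = ∑ i, condEntropy (c.joint ch) (fun ω => ω.y₁ i)
        (auxVar (fun ω => (ω.m₀, ω.s)) i) ∧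
      n * z.2.1.2 = ∑ i, condEntropy (c.joint ch) (fun ω => ω.y₂ i)
        (auxVar (fun ω => (ω.m₀, ω.s)) i) ∧
      n * z.2.2.1.1 = ∑ i, condEntropy (c.joint ch) (fun ω => ω.y₁ i)
        (auxVar (fun ω => (ω.m₀, ω.m₁, ω.s)) i) ∧
      n * z.2.2.1.2 = ∑ i, condEntropy (c.joint ch) (fun ω => ω.y₂ i)
        (auxVar (fun ω => (ω.m₀, ω.m₁, ω.s)) i) ∧
      n * z.2.2.2.1 = ∑ i, condEntropy (c.joint ch) (fun ω => ω.y₁ i)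
        (auxVar (fun ω => (ω.m₀, ω.m₂, ω.s)) i) ∧
      n * z.2.2.2.2 = ∑ i, condEntropy (c.joint ch) (fun ω => ω.y₂ i)
        (auxVar (fun ω => (ω.m₀, ω.m₂, ω.s)) i) := by
  have hn0 : (n : ℝ) ≠ 0 := by exact_mod_cast hn.ne'
  have hp := c.joint_nonneg ch
  set p := c.joint ch with hpdef
  set Zv : Fin n → Outcome n M₀ M₁ M₂ S Y₁ Y₂ → _ := fun i => auxVar (fun ω => (ω.m₀, ω.s)) i
    with hZv
  have hZ : ∀ i ω b, Zv i (ω.replaceOutput i b) = Zv i ω := fun i =>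
    auxVar_replaceOutput fun _ _ => rfl
  have hone : ∀ i, ∑ z, ∑ w, law p (fun ω => (Zv i ω, ω.s i, c.input ω i)) (z, w) = 1 :=
    fun i => by
      rw [← Fintype.sum_prod_type', sum_law, hpdef, c.sum_joint ch]
  -- The index of the decomposition is the time together with the value of `Zv`, and `(n : ℝ)⁻¹` is
  -- the law of the uniform time index; the messages `M₁` and `M₂` index the two refinements.
  have h := sum_mem_splitHull (J := Fin n × _) (U := M₁) (V := M₂) ch.outputH_smul
    (fun j => (n : ℝ)⁻¹ • fun w =>
      law p (fun ω => (Zv j.1 ω, ω.s j.1, c.input ω j.1)) (j.2, w))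
    (fun j u => (n : ℝ)⁻¹ • fun w =>
      law p (fun ω => ((Zv j.1 ω, ω.m₁), ω.s j.1, c.input ω j.1)) ((j.2, u), w))
    (fun j v => (n : ℝ)⁻¹ • fun w =>
      law p (fun ω => ((Zv j.1 ω, ω.m₂), ω.s j.1, c.input ω j.1)) ((j.2, v), w))
    (fun j u i => mul_nonneg (by positivity) (law_nonneg hp _ _))
    (fun j v i => mul_nonneg (by positivity) (law_nonneg hp _ _))
    (fun j => by
      rw [← Finset.smul_sum]; congr 1; ext w
      rw [Finset.sum_apply]
      exact sum_law_pair_left p (Zv j.1) (fun ω => ω.m₁) _ j.2 w)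
    (fun j => by
      rw [← Finset.smul_sum]; congr 1; ext w
      rw [Finset.sum_apply]
      exact sum_law_pair_left p (Zv j.1) (fun ω => ω.m₂) _ j.2 w)
    (by
      simp only [Pi.smul_apply, smul_eq_mul, ← Finset.mul_sum]
      rw [Fintype.sum_prod_type]
      simp [hone, hn0])
  have hq : ∑ j : Fin n × _, (n : ℝ)⁻¹ • (fun w =>
      law p (fun ω => (Zv j.1 ω, ω.s j.1, c.input ω j.1)) (j.2, w)) =
      (n : ℝ)⁻¹ • ∑ i, law p (fun ω => (ω.s i, c.input ω i)) := by
    rw [← Finset.smul_sum, Fintype.sum_prod_type]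
    congr 1
    refine Finset.sum_congr rfl fun i _ => ?_
    ext w
    rw [Finset.sum_apply]
    exact sum_law_pair p (Zv i) (fun ω => (ω.s i, c.input ω i)) w
  refine ⟨_, h, fun s => ?_, hq, ?_, ?_, ?_, ?_, ?_, ?_⟩
  · refine (Finset.sum_congr rfl fun x _ => congrFun hq (s, x)).trans ?_
    simp only [Pi.smul_apply, Finset.sum_apply, smul_eq_mul, ← Finset.mul_sum]
    rw [Finset.sum_comm, inv_mul_eq_iff_eq_mul₀ hn0]
    have : ∀ i, ∑ x, law p (fun ω => (ω.s i, c.input ω i)) (s, x) = ch.stateP s := fun i => by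
      rw [← c.law_state_apply ch i, ← sum_law_pair _ (fun ω => c.input ω i)]
      exact Finset.sum_congr rfl fun x _ => law_swap _ _ _ _ _
    simp [this]
  · rw [Prod.fst_sum, Fintype.sum_prod_type]
    refine (congrArg (fun x : ℝ => n * x)
      (c.sum_outH_disintegrated ch Prod.fst Zv hZ)).trans ?_
    rw [mul_inv_cancel_left₀ hn0]
    -- The auxiliary variable contains the whole state sequence, so conditioning on `ω.s i` as well
    -- changes nothing.
    refine Finset.sum_congr rfl fun i _ => condEntropy_congr_right hp _ fun ω ω' => ?_
    simp only [hZv, auxVar, Prod.mk.injEq, and_iff_left_iff_imp, and_imp]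
    exact fun _ h _ _ => congrFun h i
  · rw [Prod.snd_sum, Fintype.sum_prod_type]
    refine (congrArg (fun x : ℝ => n * x)
      (c.sum_outH_disintegrated ch Prod.snd Zv hZ)).trans ?_
    rw [mul_inv_cancel_left₀ hn0]
    refine Finset.sum_congr rfl fun i _ => condEntropy_congr_right hp _ fun ω ω' => ?_
    simp only [hZv, auxVar, Prod.mk.injEq, and_iff_left_iff_imp, and_imp]
    exact fun _ h _ _ => congrFun h i
  · simp only [Prod.fst_sum]
    rw [← Fintype.sum_prod_type', ← (Equiv.prodAssoc _ _ _).symm.sum_comp, Fintype.sum_prod_type]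
    refine (congrArg (fun x : ℝ => n * x)
      (c.sum_outH_disintegrated ch Prod.fst (fun i ω => (Zv i ω, ω.m₁))
        fun i ω b => Prod.ext (hZ i ω b) rfl)).trans ?_
    rw [mul_inv_cancel_left₀ hn0]
    refine Finset.sum_congr rfl fun i _ => condEntropy_congr_right hp _ fun ω ω' => ?_
    simp only [hZv, auxVar, Prod.mk.injEq]
    have := fun h : ω.s = ω'.s => congrFun h i
    tauto
  · simp only [Prod.snd_sum]
    rw [← Fintype.sum_prod_type', ← (Equiv.prodAssoc _ _ _).symm.sum_comp, Fintype.sum_prod_type]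
    refine (congrArg (fun x : ℝ => n * x)
      (c.sum_outH_disintegrated ch Prod.snd (fun i ω => (Zv i ω, ω.m₁))
        fun i ω b => Prod.ext (hZ i ω b) rfl)).trans ?_
    rw [mul_inv_cancel_left₀ hn0]
    refine Finset.sum_congr rfl fun i _ => condEntropy_congr_right hp _ fun ω ω' => ?_
    simp only [hZv, auxVar, Prod.mk.injEq]
    have := fun h : ω.s = ω'.s => congrFun h i
    tauto
  · simp only [Prod.fst_sum]
    rw [← Fintype.sum_prod_type', ← (Equiv.prodAssoc _ _ _).symm.sum_comp, Fintype.sum_prod_type]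
    refine (congrArg (fun x : ℝ => n * x)
      (c.sum_outH_disintegrated ch Prod.fst (fun i ω => (Zv i ω, ω.m₂))
        fun i ω b => Prod.ext (hZ i ω b) rfl)).trans ?_
    rw [mul_inv_cancel_left₀ hn0]
    refine Finset.sum_congr rfl fun i _ => condEntropy_congr_right hp _ fun ω ω' => ?_
    simp only [hZv, auxVar, Prod.mk.injEq]
    have := fun h : ω.s = ω'.s => congrFun h i
    tauto
  · simp only [Prod.snd_sum]
    rw [← Fintype.sum_prod_type', ← (Equiv.prodAssoc _ _ _).symm.sum_comp, Fintype.sum_prod_type]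
    refine (congrArg (fun x : ℝ => n * x)
      (c.sum_outH_disintegrated ch Prod.snd (fun i ω => (Zv i ω, ω.m₂))
        fun i ω b => Prod.ext (hZ i ω b) rfl)).trans ?_
    rw [mul_inv_cancel_left₀ hn0]
    refine Finset.sum_congr rfl fun i _ => condEntropy_congr_right hp _ fun ω ω' => ?_
    simp only [hZv, auxVar, Prod.mk.injEq]
    have := fun h : ω.s = ω'.s => congrFun h i
    tauto

end Converse

/-! ### Block inequalities: outputs, leakage, Fano, and their combination -/

section BlockBounds

set_option linter.unusedSectionVars false

variable {n : ℕ} {M₀ M₁ M₂ S X Y₁ Y₂ : Type*} [Fintype M₀] [Fintype M₁] [Fintype M₂]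
  [Fintype S] [Fintype X] [Fintype Y₁] [Fintype Y₂]
  (c : Code n M₀ M₁ M₂ S X Y₁ Y₂) (ch : Channel S X Y₁ Y₂)

theorem Code.sum_condEntropy_output_le {Y : Type*} [Fintype Y] (π : Y₁ × Y₂ → Y) (hn : 0 < n) :
    ∑ i, condEntropy (c.joint ch) (fun ω => π (ω.y₁ i, ω.y₂ i)) (fun ω => ω.s i) ≤
      n * outH (marginalKernel π ch.trans)
        ((n : ℝ)⁻¹ • ∑ i, law (c.joint ch) fun ω => (ω.s i, c.input ω i)) := by
  have hn0 : (n : ℝ) ≠ 0 := by exact_mod_cast hn.ne'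
  rw [outH_smul, mul_inv_cancel_left₀ hn0]
  simp only [fun i => (c.resampling_joint ch i).condEntropy_output_state π]
  exact sum_outH_le (marginalKernel_nonneg π ch.trans_mem)
    fun i => law_nonneg (c.joint_nonneg ch) _

theorem Code.sum_condEntropy_state_le {Y : Type*} [Fintype Y] (π : Y₁ × Y₂ → Y) (hn : 0 < n) :
    ∑ i, condEntropy (c.joint ch) (fun ω => ω.s i) (fun ω => π (ω.y₁ i, ω.y₂ i)) ≤
      n * inH (marginalKernel π ch.trans)
        ((n : ℝ)⁻¹ • ∑ i, law (c.joint ch) fun ω => (ω.s i, c.input ω i)) := by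
  have hn0 : (n : ℝ) ≠ 0 := by exact_mod_cast hn.ne'
  rw [inH_smul, mul_inv_cancel_left₀ hn0]
  simp only [fun i => (c.resampling_joint ch i).condEntropy_state π]
  exact sum_inH_le (marginalKernel_nonneg π ch.trans_mem)
    fun i => law_nonneg (c.joint_nonneg ch) _

/-- `noiseH` is linear in the measure, and all messages with the state sequence determine the input
at time `i`. Past and future outputs are then irrelevant by the Markov property. -/
theorem Code.noiseH_eq_sum {Y : Type*} [Fintype Y] (π : Y₁ × Y₂ → Y) (hn : 0 < n) :
    n * noiseH (marginalKernel π ch.trans)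
        ((n : ℝ)⁻¹ • ∑ i, law (c.joint ch) fun ω => (ω.s i, c.input ω i)) =
      ∑ i, condEntropy (c.joint ch) (fun ω => π (ω.y₁ i, ω.y₂ i))
        (auxVar (fun ω => (ω.m₀, ω.m₁, ω.m₂, ω.s)) i) := by
  have hn0 : (n : ℝ) ≠ 0 := by exact_mod_cast hn.ne'
  rw [noiseH_smul, mul_inv_cancel_left₀ hn0, noiseH_sum]
  refine Finset.sum_congr rfl fun i _ => ?_
  rw [← (c.resampling_joint ch i).condEntropy_output_input π
    (Zv := auxVar (fun ω => (ω.m₀, ω.m₁, ω.m₂, ω.s)) i) (auxVar_replaceOutput fun _ _ => rfl)]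
  refine condEntropy_congr_right (c.joint_nonneg ch) _ fun ω ω' => ?_
  simp only [auxVar, Prod.mk.injEq, and_iff_left_iff_imp, and_imp]
  intro h0 h1 h2 h3 _ _
  simp only [h3, Code.input, h0, h1, h2, and_self]

theorem Code.outputs_le_outH₁ (hn : 0 < n) :
    entropy (c.joint ch) (fun ω => (ω.s, ω.y₁)) - entropy (c.joint ch) (fun ω => ω.s) ≤
      n * outH ch.trans₁
        ((n : ℝ)⁻¹ • ∑ i, law (c.joint ch) fun ω => (ω.s i, c.input ω i)) :=
  (entropy_sequence_le (c.joint_nonneg ch) (fun ω => ω.y₁) (fun ω => ω.s) (fun i ω => ω.s i)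
    fun i _ _ h => congrFun h i).trans (c.sum_condEntropy_output_le ch Prod.fst hn)

theorem Code.outputs_le_outH₂ (hn : 0 < n) :
    entropy (c.joint ch) (fun ω => (ω.s, ω.y₂)) - entropy (c.joint ch) (fun ω => ω.s) ≤
      n * outH ch.trans₂
        ((n : ℝ)⁻¹ • ∑ i, law (c.joint ch) fun ω => (ω.s i, c.input ω i)) :=
  (entropy_sequence_le (c.joint_nonneg ch) (fun ω => ω.y₂) (fun ω => ω.s) (fun i ω => ω.s i)
    fun i _ _ h => congrFun h i).trans (c.sum_condEntropy_output_le ch Prod.snd hn)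

theorem Code.sum_auxVar_identity {C : Type*} [Fintype C] (Cv : Outcome n M₀ M₁ M₂ S Y₁ Y₂ → C) :
    ∑ i, condEntropy (c.joint ch) (fun ω => ω.y₁ i) (auxVar Cv i) -
      (entropy (c.joint ch) (fun ω => (Cv ω, ω.y₁)) - entropy (c.joint ch) Cv) =
    ∑ i, condEntropy (c.joint ch) (fun ω => ω.y₂ i) (auxVar Cv i) -
      (entropy (c.joint ch) (fun ω => (Cv ω, ω.y₂)) - entropy (c.joint ch) Cv) :=
  csiszar_sum_identity (c.joint_nonneg ch) Cv (fun ω => ω.y₁) (fun ω => ω.y₂)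

theorem Code.sum_auxVar_le {C : Type*} [Fintype C] (Cv : Outcome n M₀ M₁ M₂ S Y₁ Y₂ → C) :
    ∑ i, condEntropy (c.joint ch) (fun ω => ω.y₁ i) (auxVar Cv i) ≤
      entropy (c.joint ch) (fun ω => (Cv ω, ω.y₁)) - entropy (c.joint ch) Cv :=
  sum_condEntropy_le (c.joint_nonneg ch) Cv (fun ω => ω.y₁) (fun ω => ω.y₂)

variable [Nonempty M₀] [Nonempty M₁] [Nonempty M₂]

/-- Single-letterization of the information leakage about the state. -/
theorem Code.leakage_le {Y : Type*} [Fintype Y] (π : Y₁ × Y₂ → Y) (hn : 0 < n)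
    (y : Outcome n M₀ M₁ M₂ S Y₁ Y₂ → Fin n → Y) (hy : ∀ ω i, π (ω.y₁ i, ω.y₂ i) = y ω i)
    {E : ℝ} (hE : (1 / n : ℝ) * mutualInfo (c.joint ch) (fun ω => ω.s) y ≤ E) :
    ∑ s, negMulLog2 (ch.stateP s) - inH (marginalKernel π ch.trans)
      ((n : ℝ)⁻¹ • ∑ i, law (c.joint ch) fun ω => (ω.s i, c.input ω i)) ≤ E := by
  have hn0 : (0 : ℝ) < n := by exact_mod_cast hn
  have hp := c.joint_nonneg ch
  refine le_trans ?_ hE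
  -- The states are i.i.d., so the entropy of the state sequence is known exactly and only
  -- $H(S^n|Y^n)$ has to be bounded, from above.
  rw [one_div, le_inv_mul_iff₀ hn0, mul_sub, ← c.entropy_state ch, mutualInfo, condEntropy_eq hp]
  refine sub_le_sub_left (le_trans ?_ (c.sum_condEntropy_state_le ch π hn)) _
  simp only [hy]
  rw [entropy_congr (X := fun ω => (ω.s, y ω)) (Y := fun ω => (y ω, ω.s)) hp
    fun ω ω' => by simp only [Prod.mk.injEq, and_comm]]
  exact entropy_sequence_le hp (fun ω => ω.s) y (fun i ω => y ω i) fun i _ _ h => congrFun h i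

/-- The entropies of the message groups together with the state sequence. -/
theorem Code.entropy_message_groups :
    let H₀ := entropy (c.joint ch) fun ω => ω.s
    let L₀ := Real.logb 2 (Fintype.card M₀)
    let L₁ := Real.logb 2 (Fintype.card M₁)
    let L₂ := Real.logb 2 (Fintype.card M₂)
    entropy (c.joint ch) (fun ω => (ω.m₀, ω.s)) = L₀ + H₀ ∧
    entropy (c.joint ch) (fun ω => (ω.m₀, ω.m₁, ω.s)) = L₀ + L₁ + H₀ ∧
    entropy (c.joint ch) (fun ω => (ω.m₀, ω.m₂, ω.s)) = L₀ + L₂ + H₀ ∧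
    entropy (c.joint ch) (fun ω => (ω.m₀, ω.m₁, ω.m₂, ω.s)) = L₀ + L₁ + L₂ + H₀ := by
  intro H₀ L₀ L₁ L₂
  have hp := c.joint_nonneg ch
  have hp1 := c.sum_joint ch
  have h012 := c.entropy_messages_state ch
  -- The full tuple attains the sum of the individual upper bounds, so subadditivity forces every
  -- smaller group to attain its own.
  have l0 := entropy_le_card hp hp1 fun ω => ω.m₀
  have l1 := entropy_le_card hp hp1 fun ω => ω.m₁
  have l2 := entropy_le_card hp hp1 fun ω => ω.m₂
  have h0 := entropy_pair_le hp hp1 (fun ω => ω.m₀) (fun ω => ω.s)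
  have h01 := entropy_pair_le hp hp1 (fun ω => ω.m₁) (fun ω => (ω.m₀, ω.s))
  have h02 := entropy_pair_le hp hp1 (fun ω => ω.m₂) (fun ω => (ω.m₀, ω.s))
  have h12 := entropy_pair_le hp hp1 (fun ω => ω.m₂) (fun ω => (ω.m₀, ω.m₁, ω.s))
  have h21 := entropy_pair_le hp hp1 (fun ω => ω.m₁) (fun ω => (ω.m₀, ω.m₂, ω.s))
  rw [entropy_congr (Y := fun ω => (ω.m₀, ω.m₁, ω.s)) hp
    fun ω ω' => by simp only [Prod.mk.injEq]; tauto] at h01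
  rw [entropy_congr (Y := fun ω => (ω.m₀, ω.m₂, ω.s)) hp
    fun ω ω' => by simp only [Prod.mk.injEq]; tauto] at h02
  rw [entropy_congr (Y := fun ω => (ω.m₀, ω.m₁, ω.m₂, ω.s)) hp
    fun ω ω' => by simp only [Prod.mk.injEq]; tauto] at h12 h21
  exact ⟨by linarith, by linarith, by linarith, h012⟩

/-- Fano's inequality for the first receiver: messages among `(M₀, M₁)` are nearly determined by
everything that contains the output. -/
theorem Code.fano₁ {ε : ℝ} (hε : 0 ≤ ε) (herr : c.errorProb ch ≤ ε) {A B : Type*} [Fintype A]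
    [Fintype B] {R : Outcome n M₀ M₁ M₂ S Y₁ Y₂ → A} {T : Outcome n M₀ M₁ M₂ S Y₁ Y₂ → B}
    (hR : ∀ ω ω', ω.m₀ = ω'.m₀ → ω.m₁ = ω'.m₁ → T ω = T ω' → R ω = R ω')
    (hT : ∀ ω ω', T ω = T ω' → ω.y₁ = ω'.y₁) :
    entropy (c.joint ch) R - entropy (c.joint ch) T ≤
      1 + ε * (Real.logb 2 (Fintype.card M₀) + Real.logb 2 (Fintype.card M₁) +
        Real.logb 2 (Fintype.card M₂)) := by
  have hp := c.joint_nonneg ch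
  have hf := fano hp (c.sum_joint ch) (fun ω => (ω.m₀, ω.m₁)) (fun ω => ω.y₁) c.dec₁
    ((prob_mono hp fun ω h => Or.inl h).trans herr)
  -- Since `T` determines the output, conditioning on `T` instead of the output alone can only lower
  -- the uncertainty. The bound is then enlarged by the logarithm for `M₂`, to have one constant for
  -- both receivers.
  have hs := entropy_submodular hp (X := fun ω => ((ω.m₀, ω.m₁), ω.y₁)) (Y := T) (R := R)
    (T := fun ω => ω.y₁) (fun ω ω' h => by
      simp only [Prod.mk.injEq] at h
      exact hR _ _ h.1.1 h.1.2) (by simp +contextual) hT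
  have hM : 0 ≤ Real.logb 2 (Fintype.card M₂) :=
    Real.logb_nonneg one_lt_two (by exact_mod_cast Fintype.card_pos)
  rw [Fintype.card_prod, Nat.cast_mul, Real.logb_mul (by positivity) (by positivity)] at hf
  nlinarith [mul_nonneg hε hM]

/-- Fano's inequality for the second receiver. -/
theorem Code.fano₂ {ε : ℝ} (hε : 0 ≤ ε) (herr : c.errorProb ch ≤ ε) {A B : Type*} [Fintype A]
    [Fintype B] {R : Outcome n M₀ M₁ M₂ S Y₁ Y₂ → A} {T : Outcome n M₀ M₁ M₂ S Y₁ Y₂ → B}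
    (hR : ∀ ω ω', ω.m₀ = ω'.m₀ → ω.m₂ = ω'.m₂ → T ω = T ω' → R ω = R ω')
    (hT : ∀ ω ω', T ω = T ω' → ω.y₂ = ω'.y₂) :
    entropy (c.joint ch) R - entropy (c.joint ch) T ≤
      1 + ε * (Real.logb 2 (Fintype.card M₀) + Real.logb 2 (Fintype.card M₁) +
        Real.logb 2 (Fintype.card M₂)) := by
  have hp := c.joint_nonneg ch
  have hf := fano hp (c.sum_joint ch) (fun ω => (ω.m₀, ω.m₂)) (fun ω => ω.y₂) c.dec₂
    ((prob_mono hp fun ω h => Or.inr h).trans herr)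
  have hs := entropy_submodular hp (X := fun ω => ((ω.m₀, ω.m₂), ω.y₂)) (Y := T) (R := R)
    (T := fun ω => ω.y₂) (fun ω ω' h => by
      simp only [Prod.mk.injEq] at h
      exact hR _ _ h.1.1 h.1.2) (by simp +contextual) hT
  have hM : 0 ≤ Real.logb 2 (Fintype.card M₁) :=
    Real.logb_nonneg one_lt_two (by exact_mod_cast Fintype.card_pos)
  rw [Fintype.card_prod, Nat.cast_mul, Real.logb_mul (by positivity) (by positivity)] at hf
  nlinarith [mul_nonneg hε hM]

/-- A block code with small error probability and small leakage yields a single-letter point that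
satisfies the conditions up to a small slack. -/
theorem Code.exists_slackFeasible (hn : 0 < n) {ε δ R₀ R₁ R₂ E₁ E₂ : ℝ} (hε : 0 ≤ ε)
    (herr : c.errorProb ch ≤ ε)
    (hR₀ : n * R₀ ≤ Real.logb 2 (Fintype.card M₀) + 1)
    (hR₁ : n * R₁ ≤ Real.logb 2 (Fintype.card M₁) + 1)
    (hR₂ : n * R₂ ≤ Real.logb 2 (Fintype.card M₂) + 1)
    (hδ : 3 + 3 * (1 + ε * (Real.logb 2 (Fintype.card M₀) + Real.logb 2 (Fintype.card M₁) +
        Real.logb 2 (Fintype.card M₂))) ≤ n * δ)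
    (hE₁ : (1 / n : ℝ) * mutualInfo (c.joint ch) (fun ω => ω.s) (fun ω => ω.y₁) ≤ E₁ + δ)
    (hE₂ : (1 / n : ℝ) * mutualInfo (c.joint ch) (fun ω => ω.s) (fun ω => ω.y₂) ≤ E₂ + δ) :
    ∃ z ∈ splitHull ch.outputH, SlackFeasible ch R₀ R₁ R₂ E₁ E₂ (z, δ) := by
  obtain ⟨⟨q, h, a, b⟩, hz, hq, hqe, hh1, hh2, ha1, ha2, hb1, hb2⟩ :=
    c.exists_splitHull_point ch hn
  refine ⟨_, hz, hq, ?_⟩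
  dsimp only at hqe hh1 hh2 ha1 ha2 hb1 hb2 ⊢
  have hn0 : (0 : ℝ) < n := by exact_mod_cast hn
  have hp := c.joint_nonneg ch
  have hO1 := c.outputs_le_outH₁ ch hn
  have hO2 := c.outputs_le_outH₂ ch hn
  have hN1 := c.noiseH_eq_sum ch Prod.fst hn
  have hN2 := c.noiseH_eq_sum ch Prod.snd hn
  have hL1 := c.leakage_le ch Prod.fst hn _ (fun _ _ => rfl) hE₁
  have hL2 := c.leakage_le ch Prod.snd hn _ (fun _ _ => rfl) hE₂
  rw [← hqe] at hO1 hO2 hN1 hN2 hL1 hL2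
  obtain ⟨g0, g1, g2, g3⟩ := c.entropy_message_groups ch
  -- Each identity equates the defects of the two receivers for one message group; the matching
  -- inequality `d0`, ..., `d3` says that this defect is nonnegative.
  have i0 := c.sum_auxVar_identity ch fun ω => (ω.m₀, ω.s)
  have i1 := c.sum_auxVar_identity ch fun ω => (ω.m₀, ω.m₁, ω.s)
  have i2 := c.sum_auxVar_identity ch fun ω => (ω.m₀, ω.m₂, ω.s)
  have i3 := c.sum_auxVar_identity ch fun ω => (ω.m₀, ω.m₁, ω.m₂, ω.s)
  have d0 := c.sum_auxVar_le ch fun ω => (ω.m₀, ω.s)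
  have d1 := c.sum_auxVar_le ch fun ω => (ω.m₀, ω.m₁, ω.s)
  have d2 := c.sum_auxVar_le ch fun ω => (ω.m₀, ω.m₂, ω.s)
  have d3 := c.sum_auxVar_le ch fun ω => (ω.m₀, ω.m₁, ω.m₂, ω.s)
  have f01 := c.fano₁ ch hε herr (R := fun ω => ((ω.m₀, ω.s), ω.y₁)) (T := fun ω => (ω.s, ω.y₁))
    (by simp +contextual) (by simp +contextual)
  have f02 := c.fano₂ ch hε herr (R := fun ω => ((ω.m₀, ω.s), ω.y₂)) (T := fun ω => (ω.s, ω.y₂))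
    (by simp +contextual) (by simp +contextual)
  have f11 := c.fano₁ ch hε herr (R := fun ω => ((ω.m₀, ω.m₁, ω.s), ω.y₁))
    (T := fun ω => ((ω.m₀, ω.s), ω.y₁)) (by simp +contextual) (by simp +contextual)
  have f22 := c.fano₂ ch hε herr (R := fun ω => ((ω.m₀, ω.m₂, ω.s), ω.y₂))
    (T := fun ω => ((ω.m₀, ω.s), ω.y₂)) (by simp +contextual) (by simp +contextual)
  have f12 := c.fano₂ ch hε herr (R := fun ω => ((ω.m₀, ω.m₁, ω.m₂, ω.s), ω.y₂))
    (T := fun ω => ((ω.m₀, ω.m₁, ω.s), ω.y₂)) (by simp +contextual) (by simp +contextual)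
  have f21 := c.fano₁ ch hε herr (R := fun ω => ((ω.m₀, ω.m₁, ω.m₂, ω.s), ω.y₁))
    (T := fun ω => ((ω.m₀, ω.m₂, ω.s), ω.y₁)) (by simp +contextual) (by simp +contextual)
  rw [← hh1, ← hh2] at i0
  rw [← ha1, ← ha2] at i1
  rw [← hb1, ← hb2] at i2
  rw [← hN1, ← hN2] at i3
  rw [← hh1] at d0
  rw [← ha1] at d1
  rw [← hb1] at d2
  rw [← hN1] at d3
  change n * noiseH ch.trans₁ q - _ = n * noiseH ch.trans₂ q - _ at i3
  change n * noiseH ch.trans₁ q ≤ _ at d3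
  set Φ := 1 + ε * (Real.logb 2 (Fintype.card M₀) + Real.logb 2 (Fintype.card M₁) +
        Real.logb 2 (Fintype.card M₂)) with hΦ
  have hΦ1 : 1 ≤ Φ := by
    have e0 : 0 ≤ Real.logb 2 (Fintype.card M₀) :=
      Real.logb_nonneg one_lt_two (by exact_mod_cast Fintype.card_pos)
    have e1 : 0 ≤ Real.logb 2 (Fintype.card M₁) :=
      Real.logb_nonneg one_lt_two (by exact_mod_cast Fintype.card_pos)
    have e2 : 0 ≤ Real.logb 2 (Fintype.card M₂) :=
      Real.logb_nonneg one_lt_two (by exact_mod_cast Fintype.card_pos)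
    have := mul_nonneg hε (add_nonneg (add_nonneg e0 e1) e2)
    linarith
  -- The defect of the group $(M_0,S^n)$ is kept on the left. It compensates for the same defect
  -- lost when the next message is decoded, and being common to both receivers it fits both entries
  -- of the minimum.
  have hI : n * R₀ - 1 - Φ + (entropy (c.joint ch) (fun ω => ((ω.m₀, ω.s), ω.y₁)) -
      entropy (c.joint ch) (fun ω => (ω.m₀, ω.s)) - n * h.1) ≤
      n * min (outH ch.trans₁ q - h.1) (outH ch.trans₂ q - h.2) := by
    rw [mul_min_of_nonneg _ _ hn0.le]
    refine le_min ?_ ?_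
    · linarith
    · linarith
  refine ⟨?_, ?_, ?_, ?_, ?_, hL1, hL2⟩
  -- In the bounds on $R_0+R_1+R_2$ the defect of the intermediate group cancels across receivers
  -- and the final one is nonnegative. At most three rounding bits and three Fano terms accumulate,
  -- whence the slack `3 + 3 * Φ`.
  all_goals
    refine le_of_mul_le_mul_left ?_ hn0
    linarith

end BlockBounds

/-! ### From achievability to feasibility with arbitrarily small slack -/

/-- A real number that is at least one is at most twice its integer part, so rounding the message
set costs at most one bit. -/
theorem nat_mul_le_logb_msg {n : ℕ} {R : ℝ} (hR : 0 ≤ R) :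
    n * R ≤ Real.logb 2 (Fintype.card (Msg n R)) + 1 ∧
      Real.logb 2 (Fintype.card (Msg n R)) ≤ n * R ∧ Nonempty (Msg n R) := by
  have h0 : 0 ≤ n * R := by positivity
  have h1 : (1 : ℝ) ≤ 2 ^ (n * R) := Real.one_le_rpow one_le_two h0
  have h2 : 1 ≤ ⌊(2 : ℝ) ^ ((n : ℝ) * R)⌋₊ := Nat.one_le_floor_iff _ |>.2 h1
  have h3 : (1 : ℝ) ≤ ⌊(2 : ℝ) ^ ((n : ℝ) * R)⌋₊ := by exact_mod_cast h2
  have h4 := Nat.lt_floor_add_one ((2 : ℝ) ^ ((n : ℝ) * R))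
  refine ⟨?_, ?_, ⟨⟨0, h2⟩⟩⟩
  · rw [← sub_le_iff_le_add, Fintype.card_fin, Real.le_logb_iff_rpow_le one_lt_two (by linarith),
      Real.rpow_sub two_pos, Real.rpow_one, div_le_iff₀ two_pos]
    linarith
  · rw [Fintype.card_fin, Real.logb_le_iff_le_rpow one_lt_two (by linarith)]
    exact Nat.floor_le (by linarith)

theorem Achievable.exists_slackFeasible {S X Y₁ Y₂ : Type*} [Fintype S] [Fintype X] [Fintype Y₁]
    [Fintype Y₂] {ch : Channel S X Y₁ Y₂} {φ : X → NNReal} {Γ R₀ R₁ R₂ E₁ E₂ : ℝ}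
    (h : Achievable ch φ Γ R₀ R₁ R₂ E₁ E₂) {δ : ℝ} (hδ : 0 < δ) :
    ∃ z ∈ splitHull ch.outputH, SlackFeasible ch R₀ R₁ R₂ E₁ E₂ (z, δ) := by
  obtain ⟨h0, h1, h2, h⟩ := h
  set R := R₀ + R₁ + R₂ with hR
  have hR0 : 0 ≤ R := by positivity
  -- The total slack needed is at most $6+3\varepsilon nR$. This `ε` gives $3\varepsilon nR\le
  -- n\delta/2$, and $n\ge 12/\delta$ gives $6\le n\delta/2$; moreover $\varepsilon\le\delta$, as
  -- the leakage bounds require.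
  set ε := δ / (6 * (R + 1)) with hε
  have hε0 : 0 < ε := by positivity
  have hεR : ε * (6 * (R + 1)) = δ := div_mul_cancel₀ _ (by positivity)
  have hεδ : ε ≤ δ := by nlinarith
  obtain ⟨N, hN⟩ := h ε hε0
  obtain ⟨K, hK⟩ := exists_nat_gt (12 / δ)
  set n := max (max N K) 1
  have hnK : (12 / δ : ℝ) ≤ n := hK.le.trans (by
    exact_mod_cast (le_max_right N K).trans (le_max_left _ 1))
  have hn : 0 < n := lt_of_lt_of_le one_pos (le_max_right _ _)
  obtain ⟨c, -, herr, hE₁, hE₂⟩ := hN n ((le_max_left N K).trans (le_max_left _ 1))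
  obtain ⟨l0, u0, _⟩ := nat_mul_le_logb_msg (n := n) h0
  obtain ⟨l1, u1, _⟩ := nat_mul_le_logb_msg (n := n) h1
  obtain ⟨l2, u2, _⟩ := nat_mul_le_logb_msg (n := n) h2
  refine c.exists_slackFeasible ch hn hε0.le herr l0 l1 l2 ?_ (hE₁.trans (by linarith))
    (hE₂.trans (by linarith))
  rw [div_le_iff₀ hδ] at hnK
  have hn0 : (0 : ℝ) < n := by exact_mod_cast hn
  have hlog : ε * (Real.logb 2 (Fintype.card (Msg n R₀)) + Real.logb 2 (Fintype.card (Msg n R₁)) +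
      Real.logb 2 (Fintype.card (Msg n R₂))) ≤ ε * (n * R) := by
    refine mul_le_mul_of_nonneg_left ?_ hε0.le
    rw [hR]
    linarith
  have h6 : n * δ = ε * (n * R) * 6 + 6 * (n * ε) := by rw [← hεR]; ring
  have h7 : 0 < n * ε := by positivity
  linarith

end StateMasking

end

theorem proposition2 {S X Y₁ Y₂ : Type*} [Fintype S] [Fintype X] [Fintype Y₁] [Fintype Y₂]
    (ch : StateMasking.Channel S X Y₁ Y₂) (φ : X → NNReal) (Γ : ℝ) (hΓ : 0 < Γ)
    (R₀ R₁ R₂ E₁ E₂ : ℝ) (h : StateMasking.Achievable ch φ Γ R₀ R₁ R₂ E₁ E₂) :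
    ∃ (a b c : ℕ) (P : S → Fin a × Fin b × Fin c × X → ℝ),
      (∀ s, P s ∈ stdSimplex ℝ (Fin a × Fin b × Fin c × X)) ∧
      let p := StateMasking.letterJoint ch P
      let I_W_Y₁ := StateMasking.condMutualInfo p StateMasking.rvW StateMasking.rvY₁
        StateMasking.rvS
      let I_W_Y₂ := StateMasking.condMutualInfo p StateMasking.rvW StateMasking.rvY₂
        StateMasking.rvS
      let I_U_Y₁ := StateMasking.condMutualInfo p StateMasking.rvU StateMasking.rvY₁
        (fun ω => (StateMasking.rvW ω, StateMasking.rvS ω))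
      let I_V_Y₂ := StateMasking.condMutualInfo p StateMasking.rvV StateMasking.rvY₂
        (fun ω => (StateMasking.rvW ω, StateMasking.rvS ω))
      R₀ ≤ min I_W_Y₁ I_W_Y₂ ∧
      R₀ + R₁ ≤ min I_W_Y₁ I_W_Y₂ + I_U_Y₁ ∧
      R₀ + R₂ ≤ min I_W_Y₁ I_W_Y₂ + I_V_Y₂ ∧
      R₀ + R₁ + R₂ ≤ min I_W_Y₁ I_W_Y₂ + I_U_Y₁ +
        StateMasking.condMutualInfo p StateMasking.rvX StateMasking.rvY₂
          (fun ω => (StateMasking.rvW ω, StateMasking.rvU ω, StateMasking.rvS ω)) ∧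
      R₀ + R₁ + R₂ ≤ min I_W_Y₁ I_W_Y₂ +
        StateMasking.condMutualInfo p StateMasking.rvX StateMasking.rvY₁
          (fun ω => (StateMasking.rvW ω, StateMasking.rvV ω, StateMasking.rvS ω)) + I_V_Y₂ ∧
      StateMasking.mutualInfo p StateMasking.rvS StateMasking.rvY₁ ≤ E₁ ∧
      StateMasking.mutualInfo p StateMasking.rvS StateMasking.rvY₂ ≤ E₂ := by
  obtain ⟨z, hz, hf⟩ := StateMasking.exists_slackFeasible_zero fun δ hδ =>
    h.exists_slackFeasible hδ
  exact StateMasking.exists_testChannel ch R₀ R₁ R₂ E₁ E₂ hz hf
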